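/- **Setting.** Consider an irrotational equatorial Stokes wave travelling with speed $c<0$ over the flat bed $z=-d$. In the moving frame it consists of a smooth free surface $z=\eta(x)$ with $\eta>-d$, and of a velocity field $(u,w)$ and a pressure $P$, smooth on the closed fluid domain $D=\{(x,z):-d\le z\le\eta(x)\}$, with $$(u-c)u_x+wu_z+2\omega w=-P_x,\qquad (u-c)w_x+ww_z-2\omega u=-P_z-g,\qquad u_x+w_z=0,\qquad u_z-w_x=0$$ for $-d<z<\eta(x)$, with $w=(u-c)\eta'$ and $P=P_{atm}$ on $z=\eta(x)$, with $w=0$ on $z=-d$, and with $u>c$ on $D$. For some $L>0$ the functions $\eta,u,w$ are $L$-periodic in $x$; $\eta,u,P$ are even in $x$; $\eta$ is strictly increasing on $[-L/2,0]$ and strictly decreasing on $[0,L/2]$. Let $\psi$ be the stream function, $\psi_z=u-c$, $\psi_x=-w$, normalised by $\psi=0$ on the free surface, and let $m=\int_{-d}^{\eta(x)}(c-u)\,dz<0$, which is the value of $\psi$ on the bed. For $p\in[0,|m|]$ the streamline with label $p$ is $\{\psi=-p\}\subset D$; so $p=0$ is the free surface and $p=|m|$ the bed. In the fixed frame a fluid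 particle moves along a path $t\mapsto(x(t),z(t))$, $t\in\mathbb R$, with $(x(t)-ct,z(t))\in D$, $x'(t)=u(x(t)-ct,z(t))$ and $z'(t)=w(x(t)-ct,z(t))$. Its time-period is the time $T>0$ with $x(T)-cT=x(0)+L$. **Theorem.** No streamline with label $p\in[0,|m|]$ is empty, and from every point of $D$ starts (at $t=0$) such a path. The time-period of a particle exists, is unique, and depends only on the streamline on which the particle starts; call it $T(p)$. Moreover: 1. Let $s\in(-\infty,-\frac12]\cup[\frac12,\infty)\cup\{0\}$ and, if $s<0$, suppose that $(u,w)\neq(0,0)$ everywhere on $D$ (for example $u>0$ on $D$). For a particle starting on the streamline with label $p$, the generalized energy $$\mathcal E_s=\frac12\int_0^{T(p)}\big[x'(t)^2+z'(t)^2\big]^s\,dt$$ is finite and positive and depends only on $p$; the function $p\mapsto\mathcal E_s(p)$ is convex and non-increasing on $[0,|m|]$, and $\log\mathcal E_s$ is convex there. 2. Let $s\in(-\infty,\frac12]\cup[\frac32,\infty)$. For a particle starting on the streamline with label $p$, the generalized energy in the moving frame $$\mathbb E_s=\frac12\int_0^{T(p)}\big[(x'(t)-c)^2+z'(t)^2\big]^s\,dt$$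 is finite and positive and depends only on $p$; the function $p\mapsto\mathbb E_s(p)$ is convex and non-increasing on $[0,|m|]$, and $\log\mathbb E_s$ is convex there. -/

import Mathlib

open Set MeasureTheory
open scoped ContDiff

/-- The partial derivative `∂f/∂x` of a function of `(x, z)`. -/
noncomputable def partialX (f : ℝ × ℝ → ℝ) (a : ℝ × ℝ) : ℝ :=
  deriv (fun x => f (x, a.2)) a.1

/-- The partial derivative `∂f/∂z` of a function of `(x, z)`. -/
noncomputable def partialZ (f : ℝ × ℝ → ℝ) (a : ℝ × ℝ) : ℝ :=
  deriv (fun z => f (a.1, z)) a.2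

/-- The closed region `-d ≤ z ≤ η x` between a flat bed and the graph of `η`. -/
def layer (d : ℝ) (η : ℝ → ℝ) : Set (ℝ × ℝ) :=
  {a | -d ≤ a.2 ∧ a.2 ≤ η a.1}

/-- The open region `-d < z < η x`. -/
def openLayer (d : ℝ) (η : ℝ → ℝ) : Set (ℝ × ℝ) :=
  {a | -d < a.2 ∧ a.2 < η a.1}

/-- An irrotational equatorial Stokes wave: a smooth, periodic, symmetric travelling wave solution
of the two-dimensional equatorial `f`-plane Euler equations (density `1`) over a flat bed, without
stagnation points in the moving frame.  The profile `η` and the fields `u`, `w`, `P` are functions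
in the moving frame: at time `t` the velocity at the point `(x, z)` is
`(u (x - c t, z), w (x - c t, z))`. Values of the fields outside the fluid layer are irrelevant. -/
structure EquatorialStokesWave where
  /-- rotation speed of the Earth -/
  Ω : ℝ
  /-- gravitational acceleration -/
  g : ℝ
  /-- atmospheric pressure -/
  Patm : ℝ
  /-- wave speed -/
  c : ℝ
  /-- the bed is `z = -d` -/
  d : ℝ
  /-- wavelength -/
  L : ℝ
  /-- free surface -/
  η : ℝ → ℝ
  /-- horizontal velocity -/
  u : ℝ × ℝ → ℝ
  /-- vertical velocity -/
  w : ℝ × ℝ → ℝ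
  /-- pressure -/
  P : ℝ × ℝ → ℝ
  c_neg : c < 0
  L_pos : 0 < L
  bed_lt_surface : ∀ x, -d < η x
  smooth_η : ContDiff ℝ ∞ η
  smooth_u : ContDiffOn ℝ ∞ u (layer d η)
  smooth_w : ContDiffOn ℝ ∞ w (layer d η)
  smooth_P : ContDiffOn ℝ ∞ P (layer d η)
  -- no stagnation points in the moving frame
  speed_lt_u : ∀ a ∈ layer d η, c < u a
  -- the equations of motion, mass conservation and irrotationality
  euler_x : ∀ a ∈ openLayer d η,
    (u a - c) * partialX u a + w a * partialZ u a + 2 * Ω * w a = -partialX P a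
  euler_z : ∀ a ∈ openLayer d η,
    (u a - c) * partialX w a + w a * partialZ w a - 2 * Ω * u a = -partialZ P a - g
  incompressible : ∀ a ∈ openLayer d η, partialX u a + partialZ w a = 0
  irrotational : ∀ a ∈ openLayer d η, partialZ u a - partialX w a = 0
  -- the boundary conditions
  kinematic_surface : ∀ x, w (x, η x) = (u (x, η x) - c) * deriv η x
  dynamic_surface : ∀ x, P (x, η x) = Patm
  kinematic_bed : ∀ x, w (x, -d) = 0
  -- periodicity
  periodic_η : ∀ x, η (x + L) = η x
  periodic_u : ∀ a ∈ layer d η, u (a.1 + L, a.2) = u a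
  periodic_w : ∀ a ∈ layer d η, w (a.1 + L, a.2) = w a
  -- symmetry about the crest line `x = 0`
  even_η : ∀ x, η (-x) = η x
  even_u : ∀ a ∈ layer d η, u (-a.1, a.2) = u a
  even_P : ∀ a ∈ layer d η, P (-a.1, a.2) = P a
  -- strict monotonicity between crests and troughs
  strictMono_η : StrictMonoOn η (Icc (-(L / 2)) 0)
  strictAnti_η : StrictAntiOn η (Icc 0 (L / 2))

namespace EquatorialStokesWave

variable (W : EquatorialStokesWave)

/-- The fluid domain in the moving frame. -/
def domain : Set (ℝ × ℝ) := layer W.d W.η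

/-- The stream function: `ψ_z = u - c`, normalised by `ψ = 0` on the free surface
(then `ψ_x = -w`, and `ψ` equals the mass flux `m < 0` on the bed). -/
noncomputable def streamFunction (a : ℝ × ℝ) : ℝ :=
  -∫ z in a.2..W.η a.1, (W.u (a.1, z) - W.c)

/-- The relative mass flux `m = ∫_{-d}^{η(x)} (c - u(x, z)) dz`, which does not depend on `x`;
it is computed here below the crest `x = 0`. -/
noncomputable def massFlux : ℝ := ∫ z in (-W.d)..W.η 0, (W.c - W.u (0, z))

/-- The streamline with label `p ∈ [0, |m|]`, on which `ψ = -p`: the free surface has the label `0`,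
the flat bed the label `|m|`. -/
def streamline (p : ℝ) : Set (ℝ × ℝ) :=
  {a | a ∈ W.domain ∧ W.streamFunction a = -p}

/-- `t ↦ (X t, Z t)` is the path, in the fixed frame, of a particle of the fluid. -/
def IsParticlePath (X Z : ℝ → ℝ) : Prop :=
  ∀ t : ℝ, (X t - W.c * t, Z t) ∈ W.domain ∧
    HasDerivAt X (W.u (X t - W.c * t, Z t)) t ∧
    HasDerivAt Z (W.w (X t - W.c * t, Z t)) t

/-- `T` is a streamline time-period of a particle with horizontal position `X`: a positive time
after which the particle has advanced by one wavelength in the moving frame. -/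
def IsTimePeriod (X : ℝ → ℝ) (T : ℝ) : Prop :=
  0 < T ∧ X T - W.c * T = X 0 + W.L

end EquatorialStokesWave

/-- The density of the generalized energy of a path, in a frame moving with horizontal speed `v`
relative to the fixed one: the `2s`-th power of the speed. -/
noncomputable def energyDensity (v s : ℝ) (X Z : ℝ → ℝ) (t : ℝ) : ℝ :=
  ((deriv X t - v) ^ 2 + (deriv Z t) ^ 2) ^ s

/-- The generalized total energy of a path over the time interval `[0, T]`, in a frame moving with
horizontal speed `v` relative to the fixed one. -/
noncomputable def totalEnergy (v s T : ℝ) (X Z : ℝ → ℝ) : ℝ :=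
  (1 / 2) * ∫ t in (0 : ℝ)..T, energyDensity v s X Z t

/-!
In the moving frame the flow is irrotational and incompressible, so the complex velocity `U = (u -
c) - i w` is a holomorphic function of `x + i z`, and it has positive real part. As `w = 0` on the
bed, `U` extends by Schwarz reflection to the domain reflected across the bed
(`differentiableOn_of_continuousOn_of_im_ne_zero`, `EquatorialStokesWave.toSymmetricFlow`). The
complex potential `F`, with `F' = U`, maps the reflected closed domain homeomorphically, and
conformally in the interior, onto the strip `|Im F| ≤ |m|`: on each streamline `Im F` is constant
and `Re F` increases along it (`SymmetricFlow.strictMono_re_potential`,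
`SymmetricFlow.injOn_potential`, `SymmetricFlow.surjOn_potential`).

A particle moves with velocity `conj U`, so along its path `Im F` is constant and `q = Re F`
satisfies `dq / dt = |U|²`. This gives the existence of paths, the time-period `T = ∫ dq / |U|²`
over one period of the strip, and turns the energy in the frame moving with speed `v` into the
integral of `|U + c - v| ^ (2 s) / |U| ^ 2` over a horizontal segment of the strip
(`SymmetricFlow.IsPath.integral_wavelength`). For the exponents in question this integrand is `‖f‖ ^
r` with `1 ≤ r` and `f` holomorphic and periodic in the strip
(`SymmetricFlow.exists_evenLogConvex_energy`), so the energy is a logarithmically convex function of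
the height of the segment by Hardy's convexity theorem (`lineMean_le_rpow_mul_rpow`), a consequence
of Hadamard's three lines theorem. By the reflection it is also an even function of the height above
the bed. An even convex function is smallest at `0`, so the energy decreases from the surface to the
bed (`EvenLogConvex.reflected`). It has no zeros because it is positive on the surface: otherwise
the surface would be flat.
-/

/-! ### Integrals and scalar equations on the real line -/

section RealLine

open Filter Topology

lemma im_intervalIntegral (f : ℝ → ℂ) (hf : Continuous f) (a b : ℝ) :
    (∫ t in a..b, f t).im = ∫ t in a..b, (f t).im :=
  (Complex.imCLM.intervalIntegral_comp_comm (hf.intervalIntegrable a b)).symm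

lemma re_intervalIntegral (f : ℝ → ℂ) (hf : Continuous f) (a b : ℝ) :
    (∫ t in a..b, f t).re = ∫ t in a..b, (f t).re :=
  (Complex.reCLM.intervalIntegral_comp_comm (hf.intervalIntegrable a b)).symm

/-- A continuous function which strictly increases to the right of each point is strictly
monotone: its maximum over `[a, b]` can only be attained at `b`. -/
lemma strictMono_of_eventually_lt {f : ℝ → ℝ} (hf : Continuous f)
    (h : ∀ x, ∀ᶠ y in 𝓝[>] x, f x < f y) : StrictMono f := by
  intro a b hab
  obtain ⟨y, hy, hmax⟩ := isCompact_Icc.exists_isMaxOn (nonempty_Icc.2 hab.le) hf.continuousOn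
  have key : ∀ z ∈ Ico a b, ∃ w ∈ Icc a b, f z < f w := by
    intro z hz
    obtain ⟨w, hw, hw'⟩ := ((h z).and (Ioo_mem_nhdsGT hz.2)).exists
    exact ⟨w, ⟨hz.1.trans hw'.1.le, hw'.2.le⟩, hw⟩
  have hyb : y = b := by
    by_contra hne
    obtain ⟨w, hw, hlt⟩ := key y ⟨hy.1, lt_of_le_of_ne hy.2 hne⟩
    exact absurd (hmax hw) (not_le.2 hlt)
  obtain ⟨w, hw, hlt⟩ := key a ⟨le_rfl, hab⟩
  exact hlt.trans_le (hyb ▸ hmax hw)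

lemma strictMono_integral_of_pos {f : ℝ → ℝ} (hf : Continuous f) (hpos : ∀ x, 0 < f x) (a : ℝ) :
    StrictMono fun x => ∫ t in a..x, f t := by
  intro x y hxy
  have h := intervalIntegral.integral_add_adjacent_intervals 
    (hf.intervalIntegrable (μ := volume) a x) (hf.intervalIntegrable x y)
  have := intervalIntegral.intervalIntegral_pos_of_pos (hf.intervalIntegrable x y) hpos hxy
  simp only
  linarith

/-- A global solution of a scalar autonomous equation, by separation of variables: the time needed
to reach `x` is `∫ dx / f`, which runs through all of `ℝ` as `f` is bounded. -/
lemma exists_solution_of_pos_of_bounded {f : ℝ → ℝ} (hf : Continuous f) (hpos : ∀ x, 0 < f x)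
    {K : ℝ} (hK : ∀ x, f x ≤ K) (x₀ : ℝ) :
    ∃ x : ℝ → ℝ, x 0 = x₀ ∧ ∀ t, HasDerivAt x (f (x t)) t := by
  have hKpos : 0 < K := (hpos 0).trans_le (hK 0)
  have hfi : Continuous fun x => (f x)⁻¹ := hf.inv₀ fun x => (hpos x).ne'
  let A : ℝ → ℝ := fun x => ∫ t in x₀..x, (f t)⁻¹
  have hA : ∀ x, HasDerivAt A (f x)⁻¹ x := fun x => (hfi.integral_hasStrictDerivAt x₀ x).hasDerivAt
  have hA0 : A x₀ = 0 := intervalIntegral.integral_same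
  have hAc : Continuous A := continuous_iff_continuousAt.2 fun x => (hA x).continuousAt
  have hmono : StrictMono A := strictMono_integral_of_pos hfi (fun x => inv_pos.2 (hpos x)) x₀
  -- `A` grows at least linearly
  have hB : Monotone fun x => A x - K⁻¹ * x := by
    have hd : ∀ x, HasDerivAt (fun x => A x - K⁻¹ * x) ((f x)⁻¹ - K⁻¹) x := fun x => by
      have := (hA x).sub ((hasDerivAt_id x).const_mul K⁻¹)
      rw [mul_one] at this
      exact this
    refine monotone_of_deriv_nonneg (fun x => (hd x).differentiableAt) fun x => ?_
    rw [(hd x).deriv, sub_nonneg]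
    exact inv_anti₀ (hpos x) (hK x)
  have hsurj : Function.Surjective A := by
    refine hAc.surjective ?_ ?_
    · refine tendsto_atTop_mono' atTop (f₁ := fun x => K⁻¹ * x + (-(K⁻¹ * x₀))) ?_
        (tendsto_atTop_add_const_right _ _ (tendsto_id.const_mul_atTop (inv_pos.2 hKpos)))
      filter_upwards [eventually_ge_atTop x₀] with x hx
      have := hB hx
      simp only at this
      linarith
    · have hle : A ≤ᶠ[atBot] fun x => K⁻¹ * x + (-(K⁻¹ * x₀)) := by
        filter_upwards [eventually_le_atBot x₀] with x hx
        have := hB hx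
        simp only at this
        linarith
      exact tendsto_atBot_mono' atBot hle
        (tendsto_atBot_add_const_right _ _ (tendsto_id.const_mul_atBot (inv_pos.2 hKpos)))
  let e := (hmono.orderIsoOfSurjective A hsurj)
  have he : ∀ t, A (e.symm t) = t := fun t => e.apply_symm_apply t
  refine ⟨e.symm, hmono.injective ((he 0).trans hA0.symm), fun t => ?_⟩
  have := HasDerivAt.of_local_left_inverse (e.symm.continuous.continuousAt (x := t))
    (hA (e.symm t)) (inv_ne_zero (hpos _).ne') (Eventually.of_forall he)
  rwa [inv_inv] at this

end RealLine

/-! ### Removing the real axis from the singular set -/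

section Morera

open Complex Metric Topology
open scoped Interval

/-- Painlevé's theorem for the real axis: a continuous function which is holomorphic off the real
axis is holomorphic. A rectangle which meets the axis is cut along it, and Cauchy's theorem holds
for each part since it needs holomorphy in the interior only; Morera's theorem does the rest. -/
theorem differentiableOn_of_continuousOn_of_im_ne_zero {f : ℂ → ℂ} {V : Set ℂ} (hV : IsOpen V)
    (hc : ContinuousOn f V) (hd : ∀ z ∈ V, z.im ≠ 0 → DifferentiableAt ℂ f z) :
    DifferentiableOn ℂ f V := by
  refine (isConservativeOn_and_continuousOn_iff_isDifferentiableOn hV).1 ⟨?_, hc⟩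
  intro z w hzw
  have hzw' : [[z.re, w.re]] ×ℂ [[z.im, w.im]] ⊆ V := hzw
  have side : ∀ a b : ℝ, [[a, b]] ⊆ [[z.im, w.im]] → (0 ∉ Ioo (min a b) (max a b)) →
      (∫ x : ℝ in z.re..w.re, f (x + a * I)) - (∫ x : ℝ in z.re..w.re, f (x + b * I)) +
      I • (∫ y : ℝ in a..b, f (w.re + y * I)) -
      I • (∫ y : ℝ in a..b, f (z.re + y * I)) = 0 := by
    intro a b hab h0
    have hsub : [[z.re, w.re]] ×ℂ [[a, b]] ⊆ V :=
      (reProdIm_subset_iff.2 (Set.prod_mono le_rfl hab)).trans hzw'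
    have := integral_boundary_rect_eq_zero_of_continuousOn_of_differentiableOn f
      ⟨z.re, a⟩ ⟨w.re, b⟩ (hc.mono hsub) (fun p hp => by
        have hp' := mem_reProdIm.1 hp
        refine (hd p (hsub ⟨Ioo_subset_Icc_self hp'.1, Ioo_subset_Icc_self hp'.2⟩) ?_)
          |>.differentiableWithinAt
        intro h
        rw [h] at hp'
        exact h0 hp'.2)
    simpa using this
  have ii : ∀ (x : ℝ), x ∈ [[z.re, w.re]] → ∀ a b : ℝ, [[a, b]] ⊆ [[z.im, w.im]] →
      IntervalIntegrable (fun y : ℝ => f (x + y * I)) volume a b := by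
    intro x hx a b hab
    apply ContinuousOn.intervalIntegrable
    refine hc.comp (by fun_prop) ?_
    intro y hy
    apply hzw'
    simpa [mem_reProdIm] using ⟨hx, hab hy⟩
  rw [eq_neg_iff_add_eq_zero, wedgeIntegral_add_wedgeIntegral_eq]
  by_cases h0 : (0 : ℝ) ∈ Ioo (min z.im w.im) (max z.im w.im)
  · have h0' : (0 : ℝ) ∈ [[z.im, w.im]] := Ioo_subset_Icc_self h0
    have s1 : [[z.im, 0]] ⊆ [[z.im, w.im]] := uIcc_subset_uIcc_left h0'
    have s2 : [[0, w.im]] ⊆ [[z.im, w.im]] := uIcc_subset_uIcc_right h0'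
    have e1 := side z.im 0 s1 (by rintro ⟨h1, h2⟩; rcases le_total z.im 0 with h | h <;> simp_all)
    have e2 := side 0 w.im s2 (by rintro ⟨h1, h2⟩; rcases le_total w.im 0 with h | h <;> simp_all)
    rw [← intervalIntegral.integral_add_adjacent_intervals (ii w.re (by simp) _ _ s1)
      (ii w.re (by simp) _ _ s2), ← intervalIntegral.integral_add_adjacent_intervals
      (ii z.re (by simp) _ _ s1) (ii z.re (by simp) _ _ s2)]
    simp only [smul_eq_mul] at e1 e2 ⊢
    linear_combination e1 + e2
  · exact side _ _ le_rfl h0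

end Morera

/-! ### Symmetric flows and their complex potential -/

/-- A steady irrotational flow without stagnation points in the domain `|y| ≤ H x` of the complex
plane, symmetric about the real axis and periodic in `x`. The complex velocity `U = U₁ - i U₂`,
for the velocity field `(U₁, U₂)`, is holomorphic inside the domain. It is assumed to be continuous
with positive real part on all of `ℂ`, which costs nothing: a velocity given on the domain can be
extended to be constant on the vertical rays outside. -/
structure SymmetricFlow where
  /-- wavelength -/
  L : ℝ
  /-- half-height of the domain -/
  H : ℝ → ℝ
  /-- complex velocity -/
  U : ℂ → ℂ
  L_pos : 0 < L
  smooth_H : ContDiff ℝ 1 H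
  H_pos : ∀ x, 0 < H x
  H_per : ∀ x, H (x + L) = H x
  U_cont : Continuous U
  U_diff : DifferentiableOn ℂ U {Z | |Z.im| < H Z.re}
  U_re_pos : ∀ Z, 0 < (U Z).re
  U_per : ∀ Z, U (Z + L) = U Z
  U_conj : ∀ Z, U (starRingEnd ℂ Z) = starRingEnd ℂ (U Z)
  -- the upper boundary is a streamline
  U_surface : ∀ x : ℝ, (U ⟨x, H x⟩).im + (U ⟨x, H x⟩).re * deriv H x = 0

namespace SymmetricFlow

open Complex Metric Topology Filter
open scoped Interval ComplexConjugate

variable (S : SymmetricFlow)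

/-- The closed flow domain. -/
def closedDomain : Set ℂ := {Z | |Z.im| ≤ S.H Z.re}

/-- The interior of the flow domain. -/
def openDomain : Set ℂ := {Z | |Z.im| < S.H Z.re}

/-- The complex potential: the integral of `U` from `0` along the real axis and then vertically. In
the domain it is a primitive of `U`, its real part being the velocity potential and its imaginary
part the stream function, which vanishes on the real axis. -/
noncomputable def potential (Z : ℂ) : ℂ := wedgeIntegral 0 Z S.U

lemma continuous_H : Continuous S.H := S.smooth_H.continuous

lemma isClosed_closedDomain : IsClosed S.closedDomain :=
  isClosed_le (by fun_prop) (S.continuous_H.comp continuous_re)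

lemma isOpen_openDomain : IsOpen S.openDomain :=
  isOpen_lt (by fun_prop) (S.continuous_H.comp continuous_re)

lemma U_ne_zero (Z : ℂ) : S.U Z ≠ 0 := fun h => by
  have := S.U_re_pos Z
  simp [h] at this

lemma U_im_of_real (x : ℝ) : (S.U x).im = 0 := by
  have := S.U_conj x
  rw [conj_ofReal] at this
  exact conj_eq_iff_im.1 this.symm

lemma potential_eq (Z : ℂ) : S.potential Z =
    (∫ x in 0..Z.re, S.U (x : ℝ)) + I * ∫ y in 0..Z.im, S.U (Z.re + (y : ℝ) * I) := by
  simp [potential, wedgeIntegral]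

lemma continuous_potential : Continuous S.potential := by
  have hU := S.U_cont
  have : S.potential = fun Z => (∫ x in 0..Z.re, S.U (x : ℝ)) +
      I * ∫ y in 0..Z.im, S.U (Z.re + (y : ℝ) * I) := funext S.potential_eq
  rw [this]
  refine Continuous.add ?_ (continuous_const.mul ?_)
  · exact intervalIntegral.continuous_parametric_intervalIntegral_of_continuous
      (f := fun (_ : ℂ) (x : ℝ) => S.U x) (by fun_prop) continuous_re
  · exact intervalIntegral.continuous_parametric_intervalIntegral_of_continuous
      (f := fun (Z : ℂ) (y : ℝ) => S.U (Z.re + y * I)) (by fun_prop) continuous_im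

lemma potential_im (Z : ℂ) :
    (S.potential Z).im = ∫ y in 0..Z.im, (S.U (Z.re + (y : ℝ) * I)).re := by
  have hU := S.U_cont
  rw [potential_eq, add_im, im_intervalIntegral _ (by fun_prop)]
  simp only [U_im_of_real, intervalIntegral.integral_zero, zero_add, I_mul_im]
  rw [re_intervalIntegral _ (by fun_prop)]

/-- By Cauchy's theorem on thin rectangles `[Re Z, Re w] × [0, Im Z]`, the potential near `Z`
differs by a constant from the integral from `Z`. -/
lemma hasDerivAt_potential {Z : ℂ} (hZ : Z ∈ S.openDomain) :
    HasDerivAt S.potential (S.U Z) Z := by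
  have hU := S.U_cont
  have h1 : ∀ᶠ x in 𝓝 Z.re, |Z.im| < S.H x :=
    (S.continuous_H.tendsto Z.re).eventually (lt_mem_nhds hZ)
  obtain ⟨δ, hδ, hball⟩ := Metric.eventually_nhds_iff_ball.1 h1
  obtain ⟨ε, hε, hball'⟩ := Metric.isOpen_iff.1 S.isOpen_openDomain Z hZ
  have hcons : IsConservativeOn S.U (ball Z ε) :=
    (S.U_diff.mono hball').isConservativeOn
  have hd := hcons.hasDerivAt_wedgeIntegral hU.continuousOn (mem_ball_self hε)
  have key : ∀ w ∈ ball Z δ, S.potential w = wedgeIntegral Z w S.U + S.potential Z := by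
    intro w hw
    have hre : |w.re - Z.re| < δ :=
      (abs_re_le_norm (w - Z)).trans_lt (by simpa [dist_eq_norm] using hw)
    have hsub : [[Z.re, w.re]] ×ℂ [[0, Z.im]] ⊆ S.openDomain := by
      rintro p hp
      have hp' := mem_reProdIm.1 hp
      have hpim : |p.im| ≤ |Z.im| := by simpa using abs_sub_left_of_mem_uIcc hp'.2
      have hpre : p.re ∈ ball Z.re δ := by
        rw [mem_ball, Real.dist_eq]
        exact (abs_sub_left_of_mem_uIcc hp'.1).trans_lt hre
      exact hpim.trans_lt (hball _ hpre)
    have hrect := integral_boundary_rect_eq_zero_of_differentiableOn S.U ⟨Z.re, 0⟩ ⟨w.re, Z.im⟩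
      (S.U_diff.mono hsub)
    have ii : ∀ (x a b : ℝ), IntervalIntegrable (fun y : ℝ => S.U (x + y * I)) volume a b :=
      fun x a b => Continuous.intervalIntegrable (by fun_prop) a b
    have ij : ∀ (a b : ℝ), IntervalIntegrable (fun y : ℝ => S.U y) volume a b :=
      fun a b => Continuous.intervalIntegrable (by fun_prop) a b
    simp only [ofReal_zero, zero_mul, add_zero, smul_eq_mul] at hrect
    rw [potential_eq, potential_eq, wedgeIntegral, smul_eq_mul,
      ← intervalIntegral.integral_add_adjacent_intervals (ij 0 Z.re) (ij Z.re w.re),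
      ← intervalIntegral.integral_add_adjacent_intervals (ii w.re 0 Z.im) (ii w.re Z.im w.im)]
    linear_combination hrect
  refine (hd.add_const (S.potential Z)).congr_of_eventuallyEq ?_
  filter_upwards [ball_mem_nhds Z hδ] with w hw using key w hw

/-- The potential is a primitive of `U` along curves in the closed domain, including those which
touch the boundary: contracting such a curve towards the real axis moves it into the open domain,
and both sides are continuous in the contraction. -/
lemma potential_curve {γ γ' : ℝ → ℂ} (hγ : ∀ t, HasDerivAt γ (γ' t) t) (hγ' : Continuous γ')
    (hmem : ∀ t, γ t ∈ S.closedDomain) (a b : ℝ) :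
    S.potential (γ b) - S.potential (γ a) = ∫ t in a..b, S.U (γ t) * γ' t := by
  have hU := S.U_cont
  have hF := S.continuous_potential
  have hγc : Continuous γ := continuous_iff_continuousAt.2 fun t => (hγ t).continuousAt
  -- the curve contracted by the factor `1 - ε` in the vertical direction
  let Γ : ℝ → ℝ → ℂ := fun ε t => γ t - (ε * (γ t).im : ℝ) * I
  let Γ' : ℝ → ℝ → ℂ := fun ε t => γ' t - (ε * (γ' t).im : ℝ) * I
  have hΓ : ∀ ε t, HasDerivAt (Γ ε) (Γ' ε t) t := by
    intro ε t
    have h1 : HasDerivAt (fun t => (γ t).im) (γ' t).im t :=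
      (imCLM.hasFDerivAt.comp_hasDerivAt t (hγ t))
    exact (hγ t).sub (((h1.const_mul ε).ofReal_comp).mul_const I)
  have hclosed : IsClosed {ε : ℝ | S.potential (Γ ε b) - S.potential (Γ ε a) =
      ∫ t in a..b, S.U (Γ ε t) * Γ' ε t} := by
    refine isClosed_eq (by fun_prop) ?_
    exact intervalIntegral.continuous_parametric_intervalIntegral_of_continuous'
      (f := fun ε t => S.U (Γ ε t) * Γ' ε t) (by fun_prop) a b
  have hsub : Ioo (0 : ℝ) 1 ⊆ {ε : ℝ | S.potential (Γ ε b) - S.potential (Γ ε a) =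
      ∫ t in a..b, S.U (Γ ε t) * Γ' ε t} := by
    rintro ε ⟨h0, h1⟩
    have hmemε : ∀ t, Γ ε t ∈ S.openDomain := by
      intro t
      have him : (Γ ε t).im = (1 - ε) * (γ t).im := by simp [Γ]; ring
      have hre : (Γ ε t).re = (γ t).re := by simp [Γ]
      have h2 : |(γ t).im| ≤ S.H (γ t).re := hmem t
      have h3 := S.H_pos (γ t).re
      change |(Γ ε t).im| < S.H (Γ ε t).re
      rw [him, hre, abs_mul, abs_of_pos (by linarith)]
      nlinarith [abs_nonneg (γ t).im]
    rw [mem_ofPred_eq, intervalIntegral.integral_eq_sub_of_hasDerivAt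
      (f := fun t => S.potential (Γ ε t))]
    · intro t _
      exact (S.hasDerivAt_potential (hmemε t)).comp t (hΓ ε t)
    · apply Continuous.intervalIntegrable
      fun_prop
  have h0 : (0 : ℝ) ∈ closure (Ioo (0 : ℝ) 1) := by
    rw [closure_Ioo (by norm_num)]; simp
  simpa [Γ, Γ'] using closure_minimal hsub hclosed h0

/-- The increment of the potential over one wavelength. -/
noncomputable def period : ℝ := ∫ x in 0..S.L, (S.U (x : ℝ)).re

/-- The flux through the upper half of the domain, which is the value of the stream function on the
upper boundary. -/
noncomputable def flux : ℝ := ∫ y in 0..S.H 0, (S.U ((0 : ℝ) + (y : ℝ) * I)).re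

lemma period_pos : 0 < S.period := by
  have hU := S.U_cont
  exact intervalIntegral.intervalIntegral_pos_of_pos
    (Continuous.intervalIntegrable (by fun_prop) _ _) (fun x => S.U_re_pos _) S.L_pos

lemma flux_pos : 0 < S.flux := by
  have hU := S.U_cont
  exact intervalIntegral.intervalIntegral_pos_of_pos
    (Continuous.intervalIntegrable (by fun_prop) _ _) (fun x => S.U_re_pos _) (S.H_pos 0)

lemma potential_add_L (Z : ℂ) : S.potential (Z + S.L) = S.potential Z + S.period := by
  have hU := S.U_cont
  have ij : ∀ (a b : ℝ), IntervalIntegrable (fun y : ℝ => S.U y) volume a b :=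
    fun a b => Continuous.intervalIntegrable (by fun_prop) a b
  have hper : Function.Periodic (fun x : ℝ => S.U x) S.L := fun x => by
    simpa using S.U_per x
  have hvert : ∀ y : ℝ, S.U ((Z.re + S.L : ℝ) + y * I) = S.U (Z.re + y * I) := fun y => by
    rw [← S.U_per (Z.re + y * I)]; push_cast; ring_nf
  have h0 : (∫ x in (0 : ℝ)..S.L, S.U (x : ℝ)) = (S.period : ℂ) := by
    rw [period, ← intervalIntegral.integral_ofReal]
    congr 1; ext x
    exact Complex.ext (by simp) (by simp [S.U_im_of_real])
  have h1 := hper.intervalIntegral_add_eq Z.re 0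
  simp only [zero_add] at h1
  have him : (Z + S.L).im = Z.im := by simp
  have hre : (Z + S.L).re = Z.re + S.L := by simp
  rw [potential_eq, potential_eq, him, hre,
    ← intervalIntegral.integral_add_adjacent_intervals (ij 0 Z.re) (ij Z.re (Z.re + S.L)), h1, h0]
  simp only [hvert]
  ring

lemma potential_conj (Z : ℂ) : S.potential (conj Z) = conj (S.potential Z) := by
  have hvert : ∀ y : ℝ, S.U (Z.re + (-y : ℝ) * I) = conj (S.U (Z.re + y * I)) := fun y => by
    rw [← S.U_conj]; simp
  have h1 : (∫ y in (0 : ℝ)..(-Z.im), S.U (Z.re + (y : ℝ) * I))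
      = - conj (∫ y in (0 : ℝ)..Z.im, S.U (Z.re + (y : ℝ) * I)) := by
    rw [← intervalIntegral.intervalIntegral_conj]
    simp only [← hvert]
    rw [intervalIntegral.integral_comp_neg (fun y : ℝ => S.U (Z.re + (y : ℝ) * I)),
      ← intervalIntegral.integral_symm]
    simp
  have h2 : conj (∫ x in (0 : ℝ)..Z.re, S.U (x : ℝ)) = ∫ x in (0 : ℝ)..Z.re, S.U (x : ℝ) := by
    rw [← intervalIntegral.intervalIntegral_conj]
    congr 1; ext x
    exact conj_eq_iff_im.2 (S.U_im_of_real x)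
  rw [potential_eq, potential_eq, conj_re, conj_im, h1, map_add, map_mul, conj_I, h2]
  ring

lemma potential_im_strictMono (x : ℝ) :
    StrictMono fun y : ℝ => (S.potential (x + y * I)).im := by
  have hU := S.U_cont
  intro a b hab
  have ij : ∀ (a b : ℝ), IntervalIntegrable (fun y : ℝ => (S.U (x + y * I)).re) volume a b :=
    fun a b => Continuous.intervalIntegrable (by fun_prop) a b
  have : 0 < ∫ y in a..b, (S.U (x + (y : ℝ) * I)).re :=
    intervalIntegral.intervalIntegral_pos_of_pos (ij _ _) (fun x => S.U_re_pos _) hab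
  have h2 := intervalIntegral.integral_add_adjacent_intervals (ij 0 a) (ij a b)
  simp only [potential_im, add_re, ofReal_re, mul_re, I_re, mul_zero, ofReal_im, I_im,
    add_im, mul_im, mul_one, zero_add, add_zero, sub_self]
  linarith

lemma potential_im_lt_iff {Z W : ℂ} (h : Z.re = W.re) :
    (S.potential Z).im < (S.potential W).im ↔ Z.im < W.im := by
  have := (S.potential_im_strictMono Z.re).lt_iff_lt (a := Z.im) (b := W.im)
  rw [re_add_im] at this
  rwa [h, re_add_im] at this

lemma potential_ofReal_im (x : ℝ) : (S.potential x).im = 0 := by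
  rw [← conj_eq_iff_im, ← potential_conj, conj_ofReal]

/-! ### The potential maps the domain homeomorphically onto a strip -/

lemma hasDerivAt_surface (t : ℝ) :
    HasDerivAt (fun t : ℝ => (t : ℂ) + S.H t * I) (1 + deriv S.H t * I) t := by
  have h1 : HasDerivAt S.H (deriv S.H t) t :=
    (S.smooth_H.differentiable one_ne_zero t).hasDerivAt
  exact ofRealCLM.hasDerivAt.add (h1.ofReal_comp.mul_const I)

lemma surface_mem (t : ℝ) : (t : ℂ) + S.H t * I ∈ S.closedDomain := by
  simp [closedDomain, abs_of_pos (S.H_pos t)]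

lemma potential_surface_sub (a b : ℝ) :
    S.potential (b + S.H b * I) - S.potential (a + S.H a * I) =
      ((∫ t in a..b, (S.U (t + S.H t * I)).re * (1 + deriv S.H t ^ 2) : ℝ) : ℂ) := by
  have hH' : Continuous (deriv S.H) := S.smooth_H.continuous_deriv le_rfl
  rw [S.potential_curve (γ := fun t : ℝ => (t : ℂ) + S.H t * I)
    (γ' := fun t => 1 + deriv S.H t * I) S.hasDerivAt_surface (by fun_prop) S.surface_mem,
    ← intervalIntegral.integral_ofReal]
  congr 1; ext t
  have h := S.U_surface t
  rw [mk_eq_add_mul_I] at h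
  have h2 : (S.U (t + S.H t * I)).im = - (S.U (t + S.H t * I)).re * deriv S.H t := by linarith
  apply Complex.ext
  · simp [h2, sq]; ring
  · simp [h2, sq]

lemma potential_surface_im (x : ℝ) : (S.potential (x + S.H x * I)).im = S.flux := by
  have h := congrArg Complex.im (S.potential_surface_sub 0 x)
  rw [ofReal_im, sub_im, sub_eq_zero] at h
  rw [h, potential_im]
  simp [flux]

lemma mem_openDomain_iff {Z : ℂ} : Z ∈ S.openDomain ↔ |(S.potential Z).im| < S.flux := by
  have h1 := S.potential_im_lt_iff (Z := Z) (W := Z.re + S.H Z.re * I) (by simp)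
  have h2 := S.potential_im_lt_iff (Z := conj (Z.re + S.H Z.re * I)) (W := Z) (by simp)
  rw [potential_conj, conj_im] at h2
  rw [potential_surface_im] at h1 h2
  rw [abs_lt, h1, h2, openDomain, mem_ofPred_eq, abs_lt]
  simp

lemma mem_closedDomain_iff {Z : ℂ} : Z ∈ S.closedDomain ↔ |(S.potential Z).im| ≤ S.flux := by
  have h1 := S.potential_im_lt_iff (W := Z) (Z := Z.re + S.H Z.re * I) (by simp)
  have h2 := S.potential_im_lt_iff (W := conj (Z.re + S.H Z.re * I)) (Z := Z) (by simp)
  rw [potential_conj, conj_im] at h2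
  rw [potential_surface_im] at h1 h2
  rw [abs_le, ← not_lt, h2, ← not_lt, h1, closedDomain, mem_ofPred_eq, abs_le, ← not_lt, ← not_lt]
  simp

/-- Each streamline is the graph of a continuous function. -/
lemma exists_streamline_graph {p : ℝ} (hp : |p| ≤ S.flux) :
    ∃ h : ℝ → ℝ, Continuous h ∧ ∀ x, (S.potential (x + h x * I)).im = p := by
  have hF := S.continuous_potential
  have key : ∀ x : ℝ, ∃ y : ℝ, (S.potential (x + y * I)).im = p := by
    intro x
    have hc : ContinuousOn (fun y : ℝ => (S.potential (x + y * I)).im)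
      (Icc (-S.H x) (S.H x)) := by fun_prop
    have hmem : p ∈ Icc ((S.potential (x + (-S.H x : ℝ) * I)).im)
        ((S.potential (x + S.H x * I)).im) := by
      have : (x : ℂ) + (-S.H x : ℝ) * I = conj ((x : ℂ) + S.H x * I) := by simp
      rw [this, potential_conj, conj_im, potential_surface_im]
      exact abs_le.1 hp
    obtain ⟨y, _, hy⟩ := intermediate_value_Icc (by linarith [S.H_pos x]) hc hmem
    exact ⟨y, hy⟩
  choose h hh using key
  refine ⟨h, continuous_iff_continuousAt.2 fun x₀ => ?_, hh⟩
  rw [ContinuousAt, tendsto_order]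
  have hcx : ∀ y : ℝ, Tendsto (fun x : ℝ => (S.potential (x + y * I)).im) (𝓝 x₀)
      (𝓝 (S.potential (x₀ + y * I)).im) := fun y =>
    Continuous.tendsto (f := fun x : ℝ => (S.potential (x + y * I)).im) (by fun_prop) x₀
  constructor
  · intro a ha
    have h1 := S.potential_im_strictMono x₀ ha
    simp only [hh] at h1
    filter_upwards [(hcx a).eventually (gt_mem_nhds h1)] with x hx
    rw [← hh x] at hx
    exact (S.potential_im_strictMono x).lt_iff_lt.1 hx
  · intro a ha
    have h1 := S.potential_im_strictMono x₀ ha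
    simp only [hh] at h1
    filter_upwards [(hcx a).eventually (lt_mem_nhds h1)] with x hx
    rw [← hh x] at hx
    exact (S.potential_im_strictMono x).lt_iff_lt.1 hx

/-- If `F b - F a` is real for the potential `F`, it is `(b - a) V` with `V` a mean of `U` over the
segment, and `Re V > 0` makes it of the sign of `Re (b - a)`. -/
lemma re_potential_lt_of_segment {a b : ℂ} (hseg : segment ℝ a b ⊆ S.openDomain)
    (hre : a.re < b.re) (him : (S.potential a).im = (S.potential b).im) :
    (S.potential a).re < (S.potential b).re := by
  have hU := S.U_cont
  have hγ : ∀ t : ℝ, HasDerivAt (fun t : ℝ => a + t * (b - a)) (b - a) t := fun t => by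
    simpa using ((ofRealCLM.hasDerivAt (x := t)).mul_const (b - a)).const_add a
  have hint : S.potential b - S.potential a =
      (b - a) * ∫ t in (0 : ℝ)..1, S.U (a + t * (b - a)) := by
    have := intervalIntegral.integral_eq_sub_of_hasDerivAt (a := 0) (b := 1)
      (f := fun t : ℝ => S.potential (a + t * (b - a)))
      (f' := fun t : ℝ => S.U (a + t * (b - a)) * (b - a)) (fun t ht => by
        refine (S.hasDerivAt_potential (hseg ?_)).comp t (hγ t)
        rw [uIcc_of_le zero_le_one] at ht
        rw [segment_eq_image']
        exact ⟨t, ht, by simp⟩) (Continuous.intervalIntegrable (by fun_prop) _ _)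
    simp only [intervalIntegral.integral_mul_const, ofReal_one, one_mul, ofReal_zero, zero_mul,
      add_zero, add_sub_cancel] at this
    rw [← this, mul_comm]
  set V := ∫ t in (0 : ℝ)..1, S.U (a + t * (b - a)) with hV
  have hVre : 0 < V.re := by
    rw [hV, re_intervalIntegral _ (by fun_prop)]
    exact intervalIntegral.intervalIntegral_pos_of_pos
      (Continuous.intervalIntegrable (by fun_prop) _ _) (fun x => S.U_re_pos _) one_pos
  have e1 := congrArg Complex.re hint
  have e2 := congrArg Complex.im hint
  simp only [sub_re, sub_im, mul_re, mul_im] at e1 e2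
  have e3 : ((S.potential b).re - (S.potential a).re) * V.re =
      (b.re - a.re) * (V.re ^ 2 + V.im ^ 2) := by
    rw [e1]
    linear_combination V.im * (e2 + him)
  have : 0 < ((S.potential b).re - (S.potential a).re) * V.re := by
    rw [e3]
    have := sub_pos.2 hre
    positivity
  linarith [pos_of_mul_pos_left this hVre.le]

/-- The velocity potential increases along each streamline. Streamlines in the open domain are
compared on short segments; the boundary streamlines are smooth curves along which `U dz` is
positive. -/
lemma strictMono_re_potential {p : ℝ} (hp : |p| ≤ S.flux) {h : ℝ → ℝ} (hc : Continuous h)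
    (hh : ∀ x, (S.potential (x + h x * I)).im = p) :
    StrictMono fun x : ℝ => (S.potential (x + h x * I)).re := by
  have hF := S.continuous_potential
  have hH' : Continuous (deriv S.H) := S.smooth_H.continuous_deriv le_rfl
  have hHc := S.continuous_H
  have hU := S.U_cont
  have hsurf : StrictMono fun x : ℝ => (S.potential (x + S.H x * I)).re := by
    intro a b hab
    have := congrArg Complex.re (S.potential_surface_sub a b)
    rw [ofReal_re, sub_re] at this
    have hpos : 0 < ∫ t in a..b, (S.U (t + S.H t * I)).re * (1 + deriv S.H t ^ 2) :=
      intervalIntegral.intervalIntegral_pos_of_pos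
        (Continuous.intervalIntegrable (by fun_prop) _ _)
        (fun t => mul_pos (S.U_re_pos _) (by positivity)) hab
    simp only
    linarith
  rcases hp.lt_or_eq with hp | hp
  · refine strictMono_of_eventually_lt (by fun_prop) fun x₀ => ?_
    have hmem : ((x₀ : ℂ) + h x₀ * I) ∈ S.openDomain := by
      rw [mem_openDomain_iff, hh]; exact hp
    obtain ⟨ε, hε, hball⟩ := Metric.isOpen_iff.1 S.isOpen_openDomain _ hmem
    have hev : ∀ᶠ x : ℝ in 𝓝 x₀, (x : ℂ) + h x * I ∈ ball ((x₀ : ℂ) + h x₀ * I) ε :=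
      (Continuous.tendsto (f := fun x : ℝ => (x : ℂ) + h x * I) (by fun_prop) x₀).eventually
        (ball_mem_nhds _ hε)
    filter_upwards [hev.filter_mono nhdsWithin_le_nhds, self_mem_nhdsWithin] with x hx hx₀
    refine S.re_potential_lt_of_segment
      (((convex_ball _ ε).segment_subset (mem_ball_self hε) hx).trans hball) (by simpa using hx₀) ?_
    rw [hh, hh]
  · have hcases : (∀ x, h x = S.H x) ∨ ∀ x, h x = -S.H x := by
      rcases abs_eq S.flux_pos.le |>.1 hp with hp | hp
      · left; intro x
        exact (S.potential_im_strictMono x).injective ((hh x).trans (by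
          rw [hp, potential_surface_im]))
      · right; intro x
        refine (S.potential_im_strictMono x).injective ((hh x).trans ?_)
        have : (x : ℂ) + (-S.H x : ℝ) * I = conj ((x : ℂ) + S.H x * I) := by simp
        rw [this, potential_conj, conj_im, potential_surface_im, hp]
    rcases hcases with hc | hc
    · simpa only [hc] using hsurf
    · convert hsurf using 2 with x
      have : (x : ℂ) + (-S.H x : ℝ) * I = conj ((x : ℂ) + S.H x * I) := by simp
      rw [hc, this, potential_conj, conj_re]

lemma injOn_potential : InjOn S.potential S.closedDomain := by
  have hlt : ∀ a ∈ S.closedDomain, ∀ b, S.potential a = S.potential b → ¬ a.re < b.re := by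
    intro a ha b hab hlt
    have hp := S.mem_closedDomain_iff.1 ha
    obtain ⟨h, hc, hh⟩ := S.exists_streamline_graph hp
    have hon : ∀ c : ℂ, S.potential c = S.potential a → c = c.re + h c.re * I := by
      intro c hc
      have h1 : (S.potential (c.re + c.im * I)).im = (S.potential (c.re + h c.re * I)).im := by
        rw [hh, re_add_im, hc]
      have := (S.potential_im_strictMono c.re).injective h1
      rw [← this, re_add_im]
    have := S.strictMono_re_potential hp hc hh hlt
    simp only at this
    rw [← hon a rfl, ← hon b hab.symm, hab] at this
    exact lt_irrefl _ this
  intro a ha b hb hab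
  have hre : a.re = b.re := le_antisymm (not_lt.1 (hlt b hb a hab.symm)) (not_lt.1 (hlt a ha b hab))
  refine Complex.ext hre (le_antisymm ?_ ?_)
  · rw [← not_lt, ← S.potential_im_lt_iff hre.symm, hab]; exact lt_irrefl _
  · rw [← not_lt, ← S.potential_im_lt_iff hre, hab]; exact lt_irrefl _

lemma exists_bound_of_periodic {f : ℂ → ℂ} (hf : Continuous f) (hper : ∀ Z, f (Z + S.L) = f Z) :
    ∃ C, ∀ Z ∈ S.closedDomain, ‖f Z‖ ≤ C := by
  obtain ⟨M, hM⟩ := isCompact_Icc.exists_bound_of_continuousOn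
    (S.continuous_H.continuousOn (s := Icc 0 S.L))
  obtain ⟨C, hC⟩ := (isCompact_Icc.reProdIm isCompact_Icc).exists_bound_of_continuousOn
    (hf.continuousOn (s := Icc 0 S.L ×ℂ Icc (-M) M))
  refine ⟨C, fun Z hZ => ?_⟩
  obtain ⟨n, hn, -⟩ := existsUnique_sub_zsmul_mem_Ico S.L_pos Z.re 0
  have hper' : Function.Periodic f (S.L : ℂ) := hper
  have hHper : Function.Periodic S.H S.L := S.H_per
  rw [← hper'.sub_zsmul_eq n]
  apply hC
  have hre : (Z - n • (S.L : ℂ)).re = Z.re - n • S.L := by simp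
  have him : (Z - n • (S.L : ℂ)).im = Z.im := by simp
  rw [mem_reProdIm, hre, him]
  have hn' : Z.re - n • S.L ∈ Icc 0 S.L := ⟨hn.1, by simpa using hn.2.le⟩
  refine ⟨hn', abs_le.1 ?_⟩
  have h1 : |Z.im| ≤ S.H Z.re := hZ
  have h2 := hM _ hn'
  rw [hHper.sub_zsmul_eq n, Real.norm_eq_abs] at h2
  exact h1.trans ((le_abs_self _).trans h2)

/-- The potential stays at bounded distance from its linear part. -/
lemma exists_bound_potential_sub :
    ∃ C, ∀ Z ∈ S.closedDomain, ‖S.potential Z - (S.period / S.L * Z.re : ℝ)‖ ≤ C := by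
  have hF := S.continuous_potential
  refine S.exists_bound_of_periodic (by fun_prop) fun Z => ?_
  rw [potential_add_L]
  have := S.L_pos.ne'
  have h2 : S.period / S.L * (Z + S.L).re = S.period / S.L * Z.re + S.period := by
    simp; field_simp
  rw [h2]; push_cast; ring

lemma surjOn_potential : SurjOn S.potential S.closedDomain {ζ | |ζ.im| ≤ S.flux} := by
  intro ζ hζ
  have hF := S.continuous_potential
  obtain ⟨h, hc, hh⟩ := S.exists_streamline_graph hζ
  obtain ⟨C, hC⟩ := S.exists_bound_potential_sub
  have hmem : ∀ x : ℝ, (x : ℂ) + h x * I ∈ S.closedDomain := fun x => by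
    rw [mem_closedDomain_iff, hh]; exact hζ
  have hb : ∀ x : ℝ, |(S.potential (x + h x * I)).re - S.period / S.L * x| ≤ C := fun x => by
    have := (abs_re_le_norm _).trans (hC _ (hmem x))
    simpa using this
  have hk : 0 < S.period / S.L := div_pos S.period_pos S.L_pos
  have hsurj : Function.Surjective fun x : ℝ => (S.potential (x + h x * I)).re := by
    refine Continuous.surjective (by fun_prop) ?_ ?_
    · refine tendsto_atTop_mono (f := fun x => S.period / S.L * x - C)
        (fun x => by linarith [(abs_le.1 (hb x)).1]) ?_
      exact tendsto_atTop_add_const_right _ _ (tendsto_id.const_mul_atTop hk)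
    · have hle : ∀ x : ℝ, (S.potential (x + h x * I)).re ≤ S.period / S.L * x + C :=
        fun x => by linarith [(abs_le.1 (hb x)).2]
      refine tendsto_atBot_mono hle ?_
      exact tendsto_atBot_add_const_right _ _ (tendsto_id.const_mul_atBot hk)
  obtain ⟨x, hx⟩ := hsurj ζ.re
  exact ⟨_, hmem x, Complex.ext hx (hh x)⟩

lemma isProperMap_potential : IsProperMap fun Z : S.closedDomain => S.potential Z := by
  have hF := S.continuous_potential
  refine isProperMap_iff_isCompact_preimage.2 ⟨by fun_prop, fun K hK => ?_⟩
  obtain ⟨C, hC⟩ := S.exists_bound_potential_sub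
  obtain ⟨R, hR⟩ := hK.isBounded.exists_norm_le
  have hk : 0 < S.period / S.L := div_pos S.period_pos S.L_pos
  set A := (R + C) / (S.period / S.L) with hA
  obtain ⟨M, hM⟩ := (isCompact_Icc (a := -A) (b := A)).exists_bound_of_continuousOn
    S.continuous_H.continuousOn
  have hcomp : IsCompact (S.closedDomain ∩ S.potential ⁻¹' K) := by
    refine (isCompact_Icc.reProdIm isCompact_Icc).of_isClosed_subset (s := Icc (-A) A ×ℂ Icc (-M) M)
      (S.isClosed_closedDomain.inter (hK.isClosed.preimage hF)) ?_
    rintro Z ⟨hZ, hZK⟩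
    have h1 := hC Z hZ
    have h2 := hR _ hZK
    have h3 : S.period / S.L * |Z.re| ≤ R + C := by
      calc S.period / S.L * |Z.re| = ‖((S.period / S.L * Z.re : ℝ) : ℂ)‖ := by
            rw [norm_real, Real.norm_eq_abs, abs_mul, abs_of_pos hk]
        _ = ‖S.potential Z - (S.potential Z - (S.period / S.L * Z.re : ℝ))‖ := by
            rw [sub_sub_cancel]
        _ ≤ R + C := (norm_sub_le _ _).trans (add_le_add h2 h1)
    have h4 : |Z.re| ≤ A := by rwa [hA, le_div_iff₀' hk]
    have h5 : |Z.im| ≤ S.H Z.re := hZ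
    exact ⟨abs_le.1 h4, abs_le.1 (h5.trans ((le_abs_self _).trans (hM _ (abs_le.1 h4))))⟩
  have := S.isClosed_closedDomain.isClosedEmbedding_subtypeVal.isCompact_preimage hcomp
  convert this using 1
  ext Z
  simp

/-- The potential has a continuous inverse on the closed strip of half-width `flux`; it is extended
to the plane by being constant on the vertical rays outside the strip. -/
lemma exists_conformalInverse : ∃ G : ℂ → ℂ, Continuous G ∧ (∀ ζ, G ζ ∈ S.closedDomain) ∧
    ∀ ζ, |ζ.im| ≤ S.flux → S.potential (G ζ) = ζ := by
  have hfl := S.flux_pos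
  let clamp : ℂ → ℂ := fun ζ => ζ.re + (max (-S.flux) (min S.flux ζ.im) : ℝ) * I
  have hclamp : Continuous clamp := by fun_prop
  have hclamp_mem : ∀ ζ, |(clamp ζ).im| ≤ S.flux := fun ζ => by
    simp only [clamp, add_im, ofReal_im, mul_im, ofReal_re, I_im, mul_one, I_re, mul_zero,
      zero_add, add_zero, abs_le]
    exact ⟨le_max_left _ _, max_le (by linarith) (min_le_left _ _)⟩
  have hclamp_eq : ∀ ζ, |ζ.im| ≤ S.flux → clamp ζ = ζ := fun ζ hζ => by
    rw [abs_le] at hζ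
    simp only [clamp, min_eq_right hζ.2, max_eq_right hζ.1, re_add_im]
  have hex : ∀ ζ : ℂ, ∃ Z : S.closedDomain, S.potential Z = clamp ζ := fun ζ => by
    obtain ⟨Z, hZ, h⟩ := S.surjOn_potential (hclamp_mem ζ)
    exact ⟨⟨Z, hZ⟩, h⟩
  choose g hg using hex
  have hemb : IsClosedEmbedding fun Z : S.closedDomain => S.potential Z :=
    .of_continuous_injective_isClosedMap S.isProperMap_potential.continuous
      (fun a b h => Subtype.ext (S.injOn_potential a.2 b.2 h)) S.isProperMap_potential.isClosedMap
  have hgc : Continuous g := by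
    rw [hemb.isInducing.continuous_iff]
    convert hclamp using 1
    ext1 ζ
    exact hg ζ
  exact ⟨fun ζ => g ζ, by fun_prop, fun ζ => (g ζ).2, fun ζ hζ => by rw [hg, hclamp_eq ζ hζ]⟩

/-- The inverse of the complex potential on the closed strip `|Im ζ| ≤ flux`, extended to a
continuous map of the plane into the flow domain. -/
noncomputable def conformalInverse : ℂ → ℂ := S.exists_conformalInverse.choose

lemma continuous_conformalInverse : Continuous S.conformalInverse :=
  S.exists_conformalInverse.choose_spec.1

lemma conformalInverse_mem (ζ : ℂ) : S.conformalInverse ζ ∈ S.closedDomain :=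
  S.exists_conformalInverse.choose_spec.2.1 ζ

lemma potential_conformalInverse {ζ : ℂ} (hζ : |ζ.im| ≤ S.flux) :
    S.potential (S.conformalInverse ζ) = ζ :=
  S.exists_conformalInverse.choose_spec.2.2 ζ hζ

lemma conformalInverse_eq {Z ζ : ℂ} (hZ : Z ∈ S.closedDomain) (h : S.potential Z = ζ) :
    S.conformalInverse ζ = Z := by
  refine S.injOn_potential (S.conformalInverse_mem _) hZ ?_
  rw [S.potential_conformalInverse (h ▸ S.mem_closedDomain_iff.1 hZ), h]

lemma closedDomain_add_L {Z : ℂ} (hZ : Z ∈ S.closedDomain) : Z + S.L ∈ S.closedDomain := by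
  rw [mem_closedDomain_iff] at *
  simpa [potential_add_L] using hZ

lemma conformalInverse_add_period {ζ : ℂ} (hζ : |ζ.im| ≤ S.flux) :
    S.conformalInverse (ζ + S.period) = S.conformalInverse ζ + S.L :=
  S.conformalInverse_eq (S.closedDomain_add_L (S.conformalInverse_mem _))
    (by rw [potential_add_L, S.potential_conformalInverse hζ])

lemma conformalInverse_conj {ζ : ℂ} (hζ : |ζ.im| ≤ S.flux) :
    S.conformalInverse (conj ζ) = conj (S.conformalInverse ζ) := by
  refine S.conformalInverse_eq ?_ (by rw [potential_conj, S.potential_conformalInverse hζ])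
  have := S.conformalInverse_mem ζ
  rw [mem_closedDomain_iff] at *
  simpa [potential_conj] using this

lemma conformalInverse_mem_openDomain {ζ : ℂ} (hζ : |ζ.im| < S.flux) :
    S.conformalInverse ζ ∈ S.openDomain := by
  rw [mem_openDomain_iff, S.potential_conformalInverse hζ.le]; exact hζ

lemma hasDerivAt_conformalInverse {ζ : ℂ} (hζ : |ζ.im| < S.flux) :
    HasDerivAt S.conformalInverse (S.U (S.conformalInverse ζ))⁻¹ ζ := by
  refine HasDerivAt.of_local_left_inverse S.continuous_conformalInverse.continuousAt
    (S.hasDerivAt_potential (S.conformalInverse_mem_openDomain hζ)) (S.U_ne_zero _) ?_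
  have : ∀ᶠ ξ : ℂ in 𝓝 ζ, |ξ.im| < S.flux :=
    (Continuous.tendsto (f := fun ξ : ℂ => |ξ.im|) (by fun_prop) ζ).eventually (gt_mem_nhds hζ)
  filter_upwards [this] with ξ hξ using S.potential_conformalInverse hξ.le

/-- The derivative of the inverse along horizontal lines, the boundary of the strip included: there
the integrated form follows by continuity from the lines inside. -/
lemma hasDerivAt_conformalInverse_line {p : ℝ} (hp : |p| ≤ S.flux) (q : ℝ) :
    HasDerivAt (fun q : ℝ => S.conformalInverse (q + p * I))
      (S.U (S.conformalInverse (q + p * I)))⁻¹ q := by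
  have hG := S.continuous_conformalInverse
  have hU := S.U_cont
  have hUi : Continuous fun ζ => (S.U (S.conformalInverse ζ))⁻¹ :=
    (hU.comp hG).inv₀ fun ζ => S.U_ne_zero _
  have key : ∀ b : ℝ, S.conformalInverse (b + p * I) - S.conformalInverse ((0 : ℝ) + p * I) =
      ∫ q in (0 : ℝ)..b, (S.U (S.conformalInverse (q + p * I)))⁻¹ := by
    intro b
    have hclosed : IsClosed {ε : ℝ | S.conformalInverse (b + (ε * p : ℝ) * I) -
        S.conformalInverse ((0 : ℝ) + (ε * p : ℝ) * I) =
        ∫ q in (0 : ℝ)..b, (S.U (S.conformalInverse (q + (ε * p : ℝ) * I)))⁻¹} := by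
      refine isClosed_eq (by fun_prop) ?_
      refine intervalIntegral.continuous_parametric_intervalIntegral_of_continuous'
        (f := fun (ε q : ℝ) => (S.U (S.conformalInverse (q + (ε * p : ℝ) * I)))⁻¹) ?_ 0 b
      exact hUi.comp (by fun_prop : Continuous fun x : ℝ × ℝ => (x.2 : ℂ) + (x.1 * p : ℝ) * I)
    have hsub : Ioo (0 : ℝ) 1 ⊆ {ε : ℝ | S.conformalInverse (b + (ε * p : ℝ) * I) -
        S.conformalInverse ((0 : ℝ) + (ε * p : ℝ) * I) =
        ∫ q in (0 : ℝ)..b, (S.U (S.conformalInverse (q + (ε * p : ℝ) * I)))⁻¹} := by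
      rintro ε ⟨h0, h1⟩
      have hlt : |ε * p| < S.flux := by
        rw [abs_mul, abs_of_pos h0]
        nlinarith [abs_nonneg p, S.flux_pos]
      rw [mem_ofPred_eq, intervalIntegral.integral_eq_sub_of_hasDerivAt
        (f := fun q : ℝ => S.conformalInverse (q + (ε * p : ℝ) * I))]
      · intro t _
        have h2 : HasDerivAt (fun q : ℝ => (q : ℂ) + (ε * p : ℝ) * I) 1 t :=
          ofRealCLM.hasDerivAt.add_const _
        have h3 := (S.hasDerivAt_conformalInverse (ζ := t + (ε * p : ℝ) * I)
          (by rw [add_im, ofReal_im, im_ofReal_mul, I_im, mul_one, zero_add]; exact hlt)).comp t h2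
        rw [mul_one] at h3
        exact h3
      · apply Continuous.intervalIntegrable
        exact hUi.comp (by fun_prop)
    have h0 : (1 : ℝ) ∈ closure (Ioo (0 : ℝ) 1) := by
      rw [closure_Ioo (by norm_num)]; simp
    simpa using closure_minimal hsub hclosed h0
  have hcont : Continuous fun q : ℝ => (S.U (S.conformalInverse (q + p * I)))⁻¹ :=
    hUi.comp (by fun_prop)
  have hd := (hcont.integral_hasStrictDerivAt 0 q).hasDerivAt.add_const
    (S.conformalInverse ((0 : ℝ) + p * I))
  refine hd.congr_of_eventuallyEq (Eventually.of_forall fun b => ?_)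
  simp only [← key b, sub_add_cancel]

/-! ### Particle paths -/

/-- A curve in the flow domain whose velocity is that of the flow, which is the conjugate of the
complex velocity. -/
def IsPath (γ : ℝ → ℂ) : Prop :=
  ∀ t, γ t ∈ S.closedDomain ∧ HasDerivAt γ (conj (S.U (γ t))) t

/-- The square of the speed at the point of the streamline `Im F = p` with velocity potential `q`.
-/
noncomputable def speedSq (p q : ℝ) : ℝ := normSq (S.U (S.conformalInverse (q + p * I)))

lemma continuous_speedSq (p : ℝ) : Continuous (S.speedSq p) := by
  have h1 := S.continuous_conformalInverse
  have h2 := S.U_cont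
  have h3 := continuous_normSq
  unfold speedSq
  fun_prop

lemma speedSq_pos (p q : ℝ) : 0 < S.speedSq p q := normSq_pos.2 (S.U_ne_zero _)

lemma exists_speedSq_le (p : ℝ) : ∃ K, ∀ q, S.speedSq p q ≤ K := by
  obtain ⟨C, hC⟩ := S.exists_bound_of_periodic S.U_cont S.U_per
  refine ⟨C ^ 2, fun q => ?_⟩
  rw [speedSq, normSq_eq_norm_sq]
  gcongr
  exact hC _ (S.conformalInverse_mem _)

lemma strip_mem {p : ℝ} (hp : |p| ≤ S.flux) (q : ℝ) : |((q : ℂ) + p * I).im| ≤ S.flux := by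
  simpa using hp

lemma periodic_comp_conformalInverse {α : Type*} {E : ℂ → α} (hE : ∀ Z, E (Z + S.L) = E Z)
    {p : ℝ} (hp : |p| ≤ S.flux) :
    Function.Periodic (fun q : ℝ => E (S.conformalInverse (q + p * I))) S.period := fun q => by
  have : ((q + S.period : ℝ) : ℂ) + p * I = (q + p * I) + S.period := by push_cast; ring
  simp only
  rw [this, S.conformalInverse_add_period (S.strip_mem hp q), hE]

/-- The time in which a particle on the streamline `Im F = p` advances by one wavelength. -/
noncomputable def travelTime (p : ℝ) : ℝ := ∫ q in 0..S.period, (S.speedSq p q)⁻¹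

lemma travelTime_pos (p : ℝ) : 0 < S.travelTime p :=
  intervalIntegral.intervalIntegral_pos_of_pos
    (((S.continuous_speedSq p).inv₀ fun _ => (S.speedSq_pos p _).ne').intervalIntegrable _ _)
    (fun _ => inv_pos.2 (S.speedSq_pos p _)) S.period_pos

/-- On a streamline, in terms of the velocity potential `q`, the motion is given by the scalar
equation `q' = |U|²`. -/
lemma exists_path {Z : ℂ} (hZ : Z ∈ S.closedDomain) : ∃ γ, S.IsPath γ ∧ γ 0 = Z ∧
    ∀ t, (S.potential (γ t)).im = (S.potential Z).im := by
  have hp := S.mem_closedDomain_iff.1 hZ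
  set p := (S.potential Z).im with hpdef
  obtain ⟨K, hK⟩ := S.exists_speedSq_le p
  obtain ⟨x, hx0, hx⟩ := exists_solution_of_pos_of_bounded (S.continuous_speedSq p)
    (S.speedSq_pos p) hK (S.potential Z).re
  refine ⟨fun t => S.conformalInverse (x t + p * I), fun t => ⟨S.conformalInverse_mem _, ?_⟩,
    ?_, fun t => ?_⟩
  · have h := (S.hasDerivAt_conformalInverse_line hp (x t)).scomp t (hx t)
    have hsmul : S.speedSq p (x t) • (S.U (S.conformalInverse (x t + p * I)))⁻¹ =
        conj (S.U (S.conformalInverse (x t + p * I))) := by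
      rw [speedSq, real_smul, ← mul_conj, mul_comm, ← mul_assoc, inv_mul_cancel₀ (S.U_ne_zero _),
        one_mul]
    rw [hsmul] at h
    exact h
  · simp only [hx0, hpdef, re_add_im]
    exact S.conformalInverse_eq hZ rfl
  · simp only
    rw [S.potential_conformalInverse (S.strip_mem hp _)]
    simp

variable {S} {γ : ℝ → ℂ}

namespace IsPath

lemma continuous (hγ : S.IsPath γ) : Continuous γ :=
  continuous_iff_continuousAt.2 fun t => (hγ t).2.continuousAt

lemma hasDerivAt_potential (hγ : S.IsPath γ) (t : ℝ) :
    HasDerivAt (fun t => S.potential (γ t)) (normSq (S.U (γ t)) : ℂ) t := by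
  have hU := S.U_cont
  have hc := hγ.continuous
  have hcont : Continuous fun t => S.U (γ t) * conj (S.U (γ t)) := by fun_prop
  have key : ∀ b, S.potential (γ b) =
      (∫ t in (0 : ℝ)..b, S.U (γ t) * conj (S.U (γ t))) + S.potential (γ 0) := fun b => by
    rw [← S.potential_curve (fun t => (hγ t).2) (by fun_prop) (fun t => (hγ t).1), sub_add_cancel]
  have hd := (hcont.integral_hasStrictDerivAt 0 t).hasDerivAt.add_const (S.potential (γ 0))
  rw [mul_conj] at hd
  exact hd.congr_of_eventuallyEq (Eventually.of_forall key)

lemma potential_im_eq (hγ : S.IsPath γ) (t : ℝ) :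
    (S.potential (γ t)).im = (S.potential (γ 0)).im := by
  have hd : ∀ t, HasDerivAt (fun t => (S.potential (γ t)).im) 0 t := fun t => by
    have h := imCLM.hasFDerivAt.comp_hasDerivAt t (hγ.hasDerivAt_potential t)
    rw [imCLM_apply, ofReal_im] at h
    exact h
  exact is_const_of_deriv_eq_zero (fun t => (hd t).differentiableAt) (fun t => (hd t).deriv) t 0

lemma flux_bound (hγ : S.IsPath γ) : |(S.potential (γ 0)).im| ≤ S.flux :=
  S.mem_closedDomain_iff.1 (hγ 0).1

lemma eq_conformalInverse (hγ : S.IsPath γ) (t : ℝ) :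
    S.conformalInverse ((S.potential (γ t)).re + (S.potential (γ 0)).im * I) = γ t :=
  S.conformalInverse_eq (hγ t).1 (by rw [← hγ.potential_im_eq t, re_add_im])

lemma hasDerivAt_potential_re (hγ : S.IsPath γ) (t : ℝ) :
    HasDerivAt (fun t => (S.potential (γ t)).re)
      (S.speedSq (S.potential (γ 0)).im (S.potential (γ t)).re) t := by
  have h := reCLM.hasFDerivAt.comp_hasDerivAt t (hγ.hasDerivAt_potential t)
  rw [reCLM_apply, ofReal_re] at h
  rw [speedSq, hγ.eq_conformalInverse]
  exact h

/-- Along a path, `dt = dq / |U|²`. -/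
lemma integral_eq (hγ : S.IsPath γ) {E : ℂ → ℝ} (hE : Continuous E) (a b : ℝ) :
    ∫ t in a..b, E (γ t) = ∫ q in (S.potential (γ a)).re..(S.potential (γ b)).re,
      E (S.conformalInverse (q + (S.potential (γ 0)).im * I)) /
        S.speedSq (S.potential (γ 0)).im q := by
  have hc := hγ.continuous
  have hF := S.continuous_potential
  have hG := S.continuous_conformalInverse
  set p := (S.potential (γ 0)).im with hp
  have hs := S.continuous_speedSq p
  rw [← intervalIntegral.integral_comp_mul_deriv
    (f := fun t => (S.potential (γ t)).re) (fun t _ => hγ.hasDerivAt_potential_re t)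
    (by fun_prop) (g := fun q : ℝ => E (S.conformalInverse (q + p * I)) / S.speedSq p q)]
  · congr 1; ext t
    simp only [Function.comp_apply]
    rw [← hp, div_mul_cancel₀ _ (S.speedSq_pos _ _).ne', hγ.eq_conformalInverse]
  · exact Continuous.div (by fun_prop) hs fun q => (S.speedSq_pos _ _).ne'

lemma integral_wavelength (hγ : S.IsPath γ) {E : ℂ → ℝ} (hE : Continuous E)
    (hper : ∀ Z, E (Z + S.L) = E Z) {T : ℝ}
    (hT : (S.potential (γ T)).re = (S.potential (γ 0)).re + S.period) :
    ∫ t in (0 : ℝ)..T, E (γ t) = ∫ q in (0 : ℝ)..S.period,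
      E (S.conformalInverse (q + (S.potential (γ 0)).im * I)) /
        S.speedSq (S.potential (γ 0)).im q := by
  have hP := S.periodic_comp_conformalInverse (E := fun Z => E Z / normSq (S.U Z))
    (fun Z => by simp only [hper, S.U_per]) hγ.flux_bound
  have := hP.intervalIntegral_add_eq (S.potential (γ 0)).re 0
  rw [zero_add] at this
  rw [hγ.integral_eq hE, hT]
  exact this

lemma re_eq_add_L_iff (hγ : S.IsPath γ) (τ : ℝ) :
    (γ τ).re = (γ 0).re + S.L ↔
      (S.potential (γ τ)).re = (S.potential (γ 0)).re + S.period := by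
  have him := hγ.potential_im_eq τ
  constructor
  · intro h
    have h1 : γ τ = γ 0 + S.L := by
      have hre : (γ τ).re = (γ 0 + S.L).re := by simpa using h
      have him' : (S.potential (γ τ)).im = (S.potential (γ 0 + S.L)).im := by
        rw [him, potential_add_L]; simp
      refine Complex.ext hre (le_antisymm ?_ ?_)
      · rw [← not_lt, ← S.potential_im_lt_iff hre.symm, him']; exact lt_irrefl _
      · rw [← not_lt, ← S.potential_im_lt_iff hre, him']; exact lt_irrefl _
    rw [h1, potential_add_L]; simp
  · intro h
    have h1 : γ τ = γ 0 + S.L := by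
      refine S.injOn_potential (hγ τ).1 (S.closedDomain_add_L (hγ 0).1) ?_
      rw [potential_add_L]
      exact Complex.ext (by simpa using h) (by simpa using him)
    rw [h1]; simp

lemma potential_re_travelTime_iff (hγ : S.IsPath γ) (τ : ℝ) :
    (S.potential (γ τ)).re = (S.potential (γ 0)).re + S.period ↔
      τ = S.travelTime (S.potential (γ 0)).im := by
  have h1 : ∀ τ, (S.potential (γ τ)).re = (S.potential (γ 0)).re + S.period →
      τ = S.travelTime (S.potential (γ 0)).im := fun τ h => by
    simpa [travelTime] using hγ.integral_wavelength (E := fun _ => 1) continuous_const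
      (fun _ => rfl) h
  refine ⟨h1 τ, ?_⟩
  rintro rfl
  set p := (S.potential (γ 0)).im
  have h2 : S.travelTime p = ∫ q in (S.potential (γ 0)).re..(S.potential (γ (S.travelTime p))).re,
      (S.speedSq p q)⁻¹ := by
    simpa using hγ.integral_eq (E := fun _ => 1) continuous_const 0 (S.travelTime p)
  have hP := S.periodic_comp_conformalInverse (E := fun Z => (normSq (S.U Z))⁻¹)
    (fun Z => by simp only [S.U_per]) hγ.flux_bound
  have h3 := hP.intervalIntegral_add_eq (S.potential (γ 0)).re 0
  rw [zero_add] at h3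
  have hinj := (strictMono_integral_of_pos
    ((S.continuous_speedSq p).inv₀ fun q => (S.speedSq_pos p q).ne')
    (fun q => inv_pos.2 (S.speedSq_pos p q)) (S.potential (γ 0)).re).injective
  exact hinj (h2.symm.trans h3.symm)

lemma re_eq_add_L_iff_travelTime (hγ : S.IsPath γ) (τ : ℝ) :
    (γ τ).re = (γ 0).re + S.L ↔ τ = S.travelTime (S.potential (γ 0)).im :=
  (hγ.re_eq_add_L_iff τ).trans (hγ.potential_re_travelTime_iff τ)

end IsPath

end SymmetricFlow

/-! ### Convexity of means of holomorphic functions in a strip -/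

section Hardy

open Complex Metric Topology Filter
open scoped Interval ComplexConjugate

/-- The integral of `‖f‖ ^ r` over the horizontal segment of length `Λ` starting at `p i`. -/
noncomputable def lineMean (f : ℂ → ℂ) (r Λ p : ℝ) : ℝ := ∫ q in 0..Λ, ‖f (q + p * I)‖ ^ r

lemma continuous_lineMean {f : ℂ → ℂ} (hf : Continuous f) {r : ℝ} (hr : 0 ≤ r) (Λ : ℝ) :
    Continuous (lineMean f r Λ) := by
  unfold lineMean
  refine intervalIntegral.continuous_parametric_intervalIntegral_of_continuous'
    (f := fun p q : ℝ => ‖f (q + p * I)‖ ^ r) ?_ 0 Λ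
  exact Continuous.rpow_const (f := fun x : ℝ × ℝ => ‖f (x.2 + x.1 * I)‖) (by fun_prop)
    fun _ => Or.inr hr

lemma lineMean_nonneg (f : ℂ → ℂ) (r : ℝ) {Λ : ℝ} (hΛ : 0 ≤ Λ) (p : ℝ) : 0 ≤ lineMean f r Λ p :=
  intervalIntegral.integral_nonneg hΛ fun _ _ => by positivity

/-- Hölder's inequality in the form that allows the exponents `α = 1`, `β = 0`. -/
lemma integral_rpow_mul_rpow_le {u v : ℝ → ℝ} (hu : Continuous u) (hv : Continuous v)
    (hu0 : ∀ x, 0 ≤ u x) (hv0 : ∀ x, 0 ≤ v x) {α β : ℝ} (hα : 0 ≤ α) (hβ : 0 ≤ β)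
    (hαβ : α + β = 1) {Λ : ℝ} (hΛ : 0 ≤ Λ) :
    ∫ q in 0..Λ, u q ^ α * v q ^ β ≤ (∫ q in 0..Λ, u q) ^ α * (∫ q in 0..Λ, v q) ^ β := by
  have huα : Continuous fun q => u q ^ α := hu.rpow_const fun _ => Or.inr hα
  have hvβ : Continuous fun q => v q ^ β := hv.rpow_const fun _ => Or.inr hβ
  have conv : ∀ w : ℝ → ℝ, Continuous w → (∀ x, 0 ≤ w x) →
      ENNReal.ofReal (∫ q in 0..Λ, w q) = ∫⁻ q in Ioc 0 Λ, ENNReal.ofReal (w q) := by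
    intro w hw hw0
    rw [intervalIntegral.integral_of_le hΛ]
    exact ofReal_integral_eq_lintegral_ofReal (hw.integrableOn_Icc.mono_set Ioc_subset_Icc_self)
      (Eventually.of_forall hw0)
  have hu1 : 0 ≤ ∫ q in 0..Λ, u q := intervalIntegral.integral_nonneg hΛ fun _ _ => hu0 _
  have hv1 : 0 ≤ ∫ q in 0..Λ, v q := intervalIntegral.integral_nonneg hΛ fun _ _ => hv0 _
  rw [← ENNReal.ofReal_le_ofReal_iff (by positivity),
    conv (fun q => u q ^ α * v q ^ β) (huα.mul hvβ) (fun x =>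
    mul_nonneg (Real.rpow_nonneg (hu0 x) _) (Real.rpow_nonneg (hv0 x) _)),
    ENNReal.ofReal_mul (by positivity), ← ENNReal.ofReal_rpow_of_nonneg hu1 hα,
    ← ENNReal.ofReal_rpow_of_nonneg hv1 hβ, conv u hu hu0, conv v hv hv0]
  simp only [ENNReal.ofReal_mul (Real.rpow_nonneg (hu0 _) _),
    ← ENNReal.ofReal_rpow_of_nonneg (hu0 _) hα, ← ENNReal.ofReal_rpow_of_nonneg (hv0 _) hβ]
  exact ENNReal.lintegral_mul_norm_pow_le
    (ENNReal.measurable_ofReal.comp hu.measurable).aemeasurable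
    (ENNReal.measurable_ofReal.comp hv.measurable).aemeasurable hα hβ hαβ

lemma differentiableAt_integral_translate_mul {f : ℂ → ℂ} (hf : Continuous f) {m B : ℝ}
    (hd : DifferentiableOn ℂ f {ζ | |ζ.im| < m}) (hB : ∀ ζ, ‖f ζ‖ ≤ B) {k : ℝ → ℂ}
    (hk : Measurable k) {C : ℝ} (hC : ∀ q, ‖k q‖ ≤ C) (Λ : ℝ) {ζ : ℂ} (hζ : |ζ.im| < m) :
    DifferentiableAt ℂ (fun ζ => ∫ q in (0 : ℝ)..Λ, f (q + ζ) * k q) ζ := by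
  have hopen : IsOpen {ζ : ℂ | |ζ.im| < m} := isOpen_lt (by fun_prop) continuous_const
  set ε := (m - |ζ.im|) / 2 with hε
  have hεpos : 0 < ε := by rw [hε]; linarith
  have him : ∀ q : ℝ, ∀ ξ ∈ ball ζ ε, closedBall ((q : ℂ) + ξ) (ε / 2) ⊆ {ζ : ℂ | |ζ.im| < m} := by
    intro q ξ hξ w hw
    have h1 : |ξ.im - ζ.im| < ε := by
      rw [← sub_im]; exact (abs_im_le_norm _).trans_lt (by rwa [mem_ball, dist_eq_norm] at hξ)
    have h2 : |w.im - ξ.im| ≤ ε / 2 := by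
      have h := abs_im_le_norm (w - (q + ξ))
      rw [mem_closedBall, dist_eq_norm] at hw
      simpa using h.trans hw
    have h3 : |w.im| ≤ |w.im - ξ.im| + |ξ.im - ζ.im| + |ζ.im| := by
      calc |w.im| = |(w.im - ξ.im) + (ξ.im - ζ.im) + ζ.im| := by ring_nf
        _ ≤ _ := abs_add_three _ _ _
    rw [mem_ofPred_eq]
    linarith
  have hdf : ∀ q : ℝ, ∀ ξ ∈ ball ζ ε, HasDerivAt f (deriv f (q + ξ)) (q + ξ) := fun q ξ hξ =>
    (hd.differentiableAt (hopen.mem_nhds (him q ξ hξ (mem_closedBall_self (by positivity)))))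
      |>.hasDerivAt
  have hmem : ζ ∈ ball ζ ε := mem_ball_self hεpos
  have hderiv_cont : Continuous fun q : ℝ => deriv f (q + ζ) := by
    have h1 : ContinuousOn (deriv f) {ζ : ℂ | |ζ.im| < m} := (hd.deriv hopen).continuousOn
    exact h1.comp_continuous (by fun_prop) fun q =>
      him q ζ hmem (mem_closedBall_self (by positivity))
  refine (intervalIntegral.hasDerivAt_integral_of_dominated_loc_of_deriv_le (μ := volume)
    (F := fun ζ q => f (q + ζ) * k q) (F' := fun ζ q => deriv f (q + ζ) * k q)
    (bound := fun _ => B / (ε / 2) * C) (ball_mem_nhds ζ hεpos) (Eventually.of_forall fun ξ => ?_)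
    ?_ ?_ (ae_of_all _ fun q _ ξ hξ => ?_) intervalIntegrable_const
    (ae_of_all _ fun q _ ξ hξ => ?_)).2.differentiableAt
  · exact ((by fun_prop : Continuous fun q : ℝ => f (q + ξ)).measurable.mul hk)
      |>.aestronglyMeasurable
  · rw [intervalIntegrable_iff]
    refine Measure.integrableOn_of_bounded (M := B * C) (by simp)
      ((by fun_prop : Continuous fun q : ℝ => f (q + ζ)).measurable.mul hk).aestronglyMeasurable ?_
    refine ae_of_all _ fun q => ?_
    rw [norm_mul]
    exact mul_le_mul (hB _) (hC _) (norm_nonneg _) ((norm_nonneg _).trans (hB 0))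
  · exact (hderiv_cont.measurable.mul hk).aestronglyMeasurable
  · rw [norm_mul]
    refine mul_le_mul ?_ (hC q) (norm_nonneg _)
      (div_nonneg ((norm_nonneg _).trans (hB 0)) (by positivity))
    refine norm_deriv_le_of_forall_mem_sphere_norm_le (by positivity) ?_ fun z _ => hB z
    exact (hd.mono (him q ξ hξ)).diffContOnCl_ball subset_rfl
  · have h1 : HasDerivAt (fun ξ : ℂ => (q : ℂ) + ξ) 1 ξ := (hasDerivAt_id ξ).const_add _
    have h2 := (hdf q ξ hξ).comp ξ h1
    rw [mul_one] at h2
    exact h2.mul_const _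

/-- Hardy's convexity theorem on a strip: for `f` bounded, holomorphic and of period `Λ`, the mean
of `‖f‖ ^ r` over a period is logarithmically convex in the height. The three lines theorem is
applied to `ζ ↦ ∫ f (q + ζ) k q dq`, where `k` is extremal for Hölder's inequality on the line under
consideration; by periodicity, Hölder's inequality bounds this function on the line of height `p` in
terms of the mean at `p`. -/
theorem lineMean_le_rpow_mul_rpow {f : ℂ → ℂ} (hf : Continuous f) {m B Λ r : ℝ}
    (hd : DifferentiableOn ℂ f {ζ | |ζ.im| < m}) (hB : ∀ ζ, ‖f ζ‖ ≤ B) (hΛ : 0 ≤ Λ)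
    (hper : ∀ ζ : ℂ, |ζ.im| ≤ m → f (ζ + Λ) = f ζ) (hr : 1 ≤ r) {a b : ℝ}
    (ha : a ∈ Icc (-m) m) (hb : b ∈ Icc (-m) m) {t s : ℝ} (ht : 0 ≤ t) (hs : 0 ≤ s)
    (hts : t + s = 1) :
    lineMean f r Λ (t * a + s * b) ≤ lineMean f r Λ a ^ t * lineMean f r Λ b ^ s := by
  have hr0 : 0 < r := one_pos.trans_le hr
  have hNa := lineMean_nonneg f r hΛ a
  have hNb := lineMean_nonneg f r hΛ b
  have hB0 : 0 ≤ B := (norm_nonneg _).trans (hB 0)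
  set p := t * a + s * b with hp
  have hNp := lineMean_nonneg f r hΛ p
  rcases hNp.eq_or_lt with h0 | hNpos
  · rw [← h0]; positivity
  rcases eq_or_ne a b with rfl | hab
  · have : p = a := by rw [hp, ← add_mul, hts, one_mul]
    rw [this, ← Real.rpow_add_of_nonneg hNa ht hs, hts, Real.rpow_one]
  let f₀ : ℝ → ℂ := fun q => f (q + p * I)
  have hf₀ : Continuous f₀ := by fun_prop
  -- the extremal function of Hölder's inequality on the line `Im ζ = p`
  let k : ℝ → ℂ := fun q => (‖f₀ q‖ ^ (r - 2) : ℝ) * conj (f₀ q)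
  have hk : Measurable k := by
    have h1 : Measurable fun q => ‖f₀ q‖ ^ (r - 2) := hf₀.norm.measurable.pow_const _
    have h2 : Measurable fun q => conj (f₀ q) := (by fun_prop : Continuous _).measurable
    exact (measurable_ofReal.comp h1).mul h2
  have hknorm : ∀ q, ‖k q‖ ≤ ‖f₀ q‖ ^ (r - 1) := fun q => by
    simp only [k, norm_mul, norm_real, RCLike.norm_conj, Real.norm_eq_abs]
    rw [abs_of_nonneg (by positivity)]
    rcases (norm_nonneg (f₀ q)).eq_or_lt with h | h
    · rw [← h, mul_zero]; positivity
    · rw [← Real.rpow_add_one h.ne']; apply le_of_eq; ring_nf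
  have hkC : ∀ q, ‖k q‖ ≤ B ^ (r - 1) := fun q =>
    (hknorm q).trans (Real.rpow_le_rpow (norm_nonneg _) (hB _) (by linarith))
  have hfk : ∀ q, f₀ q * k q = ((‖f₀ q‖ ^ r : ℝ) : ℂ) := fun q => by
    simp only [k]
    rw [mul_left_comm, mul_conj, ← ofReal_mul, normSq_eq_norm_sq]
    rcases (norm_nonneg (f₀ q)).eq_or_lt with h | h
    · rw [← h, Real.zero_rpow hr0.ne']; simp
    · rw [← Real.rpow_natCast, ← Real.rpow_add h]; norm_num
  let Φ : ℂ → ℂ := fun ζ => ∫ q in (0 : ℝ)..Λ, f (q + ζ) * k q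
  have hΦc : Continuous Φ := by
    refine intervalIntegral.continuous_of_dominated_interval (bound := fun _ => B * B ^ (r - 1))
      (fun ξ => ?_) (fun ξ => ae_of_all _ fun q _ => ?_) intervalIntegrable_const
      (ae_of_all _ fun q _ => by fun_prop)
    · exact ((by fun_prop : Continuous fun q : ℝ => f (q + ξ)).measurable.mul hk)
        |>.aestronglyMeasurable
    · rw [norm_mul]
      exact mul_le_mul (hB _) (hkC _) (norm_nonneg _) hB0
  have hΦp : Φ (p * I) = (lineMean f r Λ p : ℂ) := by
    simp only [Φ, lineMean]
    rw [← intervalIntegral.integral_ofReal]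
    congr 1; ext q
    exact hfk q
  set C := lineMean f r Λ p ^ (1 - 1 / r) with hC
  have hC0 : 0 < C := Real.rpow_pos_of_pos hNpos _
  have hr1 : 0 ≤ 1 - 1 / r := by
    rw [sub_nonneg, div_le_one hr0]; exact hr
  have hΦ_le : ∀ ζ : ℂ, |ζ.im| ≤ m → ‖Φ ζ‖ ≤ lineMean f r Λ ζ.im ^ (1 / r) * C := by
    intro ζ hζ
    have hshift : ∫ q in (0 : ℝ)..Λ, ‖f (q + ζ)‖ ^ r = lineMean f r Λ ζ.im := by
      -- the mean over a period does not depend on where the period starts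
      have hP : Function.Periodic (fun q : ℝ => ‖f (q + ζ.im * I)‖ ^ r) Λ := fun q => by
        have : ((q + Λ : ℝ) : ℂ) + ζ.im * I = (q + ζ.im * I) + Λ := by push_cast; ring
        simp only
        rw [this, hper _ (by simpa using hζ)]
      have h1 := hP.intervalIntegral_add_eq ζ.re 0
      rw [zero_add] at h1
      rw [lineMean, ← h1, add_comm ζ.re, ← zero_add ζ.re, ← add_assoc,
        ← intervalIntegral.integral_comp_add_right, add_zero]
      congr 1; ext q
      congr 3
      push_cast
      rw [add_assoc, re_add_im]
    have hu : Continuous fun q : ℝ => ‖f (q + ζ)‖ ^ r :=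
      (by fun_prop : Continuous fun q : ℝ => ‖f (q + ζ)‖).rpow_const fun _ => Or.inr hr0.le
    have hv : Continuous fun q : ℝ => ‖f₀ q‖ ^ r :=
      hf₀.norm.rpow_const fun _ => Or.inr hr0.le
    calc ‖Φ ζ‖ ≤ ∫ q in (0 : ℝ)..Λ, (‖f (q + ζ)‖ ^ r) ^ (1 / r) * (‖f₀ q‖ ^ r) ^ (1 - 1 / r) := by
          refine intervalIntegral.norm_integral_le_of_norm_le hΛ (ae_of_all _ fun q _ => ?_)
            (Continuous.intervalIntegrable ?_ _ _)
          · rw [norm_mul, ← Real.rpow_mul (norm_nonneg _), ← Real.rpow_mul (norm_nonneg _),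
              mul_one_div_cancel hr0.ne', Real.rpow_one]
            have : r * (1 - 1 / r) = r - 1 := by field_simp
            rw [this]
            gcongr
            exact hknorm q
          · exact (hu.rpow_const fun _ => Or.inr (by positivity)).mul
              (hv.rpow_const fun _ => Or.inr hr1)
      _ ≤ (∫ q in (0 : ℝ)..Λ, ‖f (q + ζ)‖ ^ r) ^ (1 / r) *
          (∫ q in (0 : ℝ)..Λ, ‖f₀ q‖ ^ r) ^ (1 - 1 / r) :=
        integral_rpow_mul_rpow_le hu hv (fun _ => by positivity) (fun _ => by positivity)
          (by positivity) hr1 (by ring) hΛ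
      _ = _ := by rw [hshift]; rfl
  -- the map `ξ ↦ i (a + (b - a) ξ)` takes the strip `0 ≤ Re ξ ≤ 1` to the strip between the lines
  let j : ℂ → ℂ := fun ξ => I * (a + (b - a) * ξ)
  have hj : ∀ ξ, (j ξ).im = a + (b - a) * ξ.re := fun ξ => by simp [j]
  have hjs : ∀ ξ : ℂ, ξ.re ∈ Icc (0 : ℝ) 1 → |(j ξ).im| ≤ m := fun ξ hξ => by
    rw [hj, abs_le]
    have := (convex_Icc (-m) m) ha hb (sub_nonneg.2 hξ.2) hξ.1 (sub_add_cancel _ _)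
    simp only [smul_eq_mul] at this
    have e : a + (b - a) * ξ.re = (1 - ξ.re) * a + ξ.re * b := by ring
    rw [e]; exact this
  have hjo : ∀ ξ : ℂ, ξ.re ∈ Ioo (0 : ℝ) 1 → |(j ξ).im| < m := fun ξ hξ => by
    rw [hj, abs_lt]
    obtain ⟨h1, h2⟩ := hξ
    obtain ⟨ha1, ha2⟩ := ha
    obtain ⟨hb1, hb2⟩ := hb
    rcases hab.lt_or_gt with h | h
    · constructor <;> nlinarith [mul_pos (sub_pos.2 h) h1, mul_pos (sub_pos.2 h) (sub_pos.2 h2)]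
    · constructor <;> nlinarith [mul_pos (sub_pos.2 h) h1, mul_pos (sub_pos.2 h) (sub_pos.2 h2)]
  have hjd : Differentiable ℂ j := by fun_prop
  have hdiff : DiffContOnCl ℂ (Φ ∘ j) (HadamardThreeLines.verticalStrip 0 1) := by
    refine ⟨fun ξ hξ => ?_, (hΦc.comp hjd.continuous).continuousOn⟩
    exact ((differentiableAt_integral_translate_mul hf hd hB hk hkC Λ (hjo ξ hξ)).comp ξ
      (hjd ξ)).differentiableWithinAt
  have hbdd : BddAbove ((norm ∘ (Φ ∘ j)) '' HadamardThreeLines.verticalClosedStrip 0 1) := by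
    refine ⟨B * B ^ (r - 1) * |Λ - 0|, ?_⟩
    rintro _ ⟨ξ, -, rfl⟩
    refine intervalIntegral.norm_integral_le_of_norm_le_const fun q _ => ?_
    rw [norm_mul]
    exact mul_le_mul (hB _) (hkC _) (norm_nonneg _) hB0
  have hs1 : s ≤ 1 := by linarith
  have hleft : ∀ ξ ∈ re ⁻¹' {(0 : ℝ)}, ‖(Φ ∘ j) ξ‖ ≤ lineMean f r Λ a ^ (1 / r) * C := by
    intro ξ hξ
    have hξ' : ξ.re = 0 := hξ
    have := hΦ_le (j ξ) (hjs ξ (by simp [hξ']))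
    rwa [hj, hξ', mul_zero, add_zero] at this
  have hright : ∀ ξ ∈ re ⁻¹' {(1 : ℝ)}, ‖(Φ ∘ j) ξ‖ ≤ lineMean f r Λ b ^ (1 / r) * C := by
    intro ξ hξ
    have hξ' : ξ.re = 1 := hξ
    have := hΦ_le (j ξ) (hjs ξ (by simp [hξ']))
    rwa [hj, hξ', mul_one, add_sub_cancel] at this
  have h3 := HadamardThreeLines.norm_le_interp_of_mem_verticalClosedStrip₀₁' (Φ ∘ j) (z := (s : ℂ))
    (by simpa [HadamardThreeLines.verticalClosedStrip] using ⟨hs, hs1⟩) hdiff hbdd hleft hright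
  have hjs' : j s = p * I := by
    simp only [j, hp]
    have : t = 1 - s := by linarith
    rw [this]; push_cast; ring
  rw [Function.comp_apply, hjs', hΦp, norm_real, Real.norm_of_nonneg hNp, ofReal_re,
    ← eq_sub_of_add_eq hts, Real.mul_rpow (by positivity) hC0.le,
    Real.mul_rpow (by positivity) hC0.le] at h3
  have h4 : lineMean f r Λ p ≤ (lineMean f r Λ a ^ t * lineMean f r Λ b ^ s) ^ (1 / r) * C := by
    refine h3.trans (le_of_eq ?_)
    rw [Real.mul_rpow (by positivity) (by positivity), ← Real.rpow_mul hNa, ← Real.rpow_mul hNb,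
      ← Real.rpow_mul hNa, ← Real.rpow_mul hNb, mul_comm t, mul_comm s]
    have : C ^ t * C ^ s = C := by rw [← Real.rpow_add hC0, hts, Real.rpow_one]
    linear_combination (lineMean f r Λ a ^ (1 / r * t) * lineMean f r Λ b ^ (1 / r * s)) * this
  have h5 : lineMean f r Λ p = lineMean f r Λ p ^ (1 / r) * C := by
    rw [hC, ← Real.rpow_add hNpos, add_sub_cancel, Real.rpow_one]
  rw [h5] at h4
  have h6 := le_of_mul_le_mul_right h4 hC0
  exact (Real.rpow_le_rpow_iff hNp (by positivity) (by positivity)).1 h6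

end Hardy

/-! ### Even logarithmically convex functions -/

section EvenLogConvex

/-- `N` is nonnegative and continuous and, on `[-m, m]`, even and logarithmically convex, and does
not vanish at `m`. Logarithmic convexity is stated multiplicatively, so that it makes sense before
`N` is known to have no zeros. -/
structure EvenLogConvex (N : ℝ → ℝ) (m : ℝ) : Prop where
  nonneg : ∀ p, 0 ≤ N p
  continuous : Continuous N
  even : ∀ p ∈ Icc (-m) m, N (-p) = N p
  le_mul : ∀ a ∈ Icc (-m) m, ∀ b ∈ Icc (-m) m, ∀ t s : ℝ, 0 ≤ t → 0 ≤ s → t + s = 1 →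
    N (t * a + s * b) ≤ N a ^ t * N b ^ s
  ne_zero : N m ≠ 0

namespace EvenLogConvex

variable {N : ℝ → ℝ} {m : ℝ} (h : EvenLogConvex N m)
include h

/-- A zero at `p < m` would by logarithmic convexity spread to `(p, m)`, hence to `m`. -/
lemma pos {p : ℝ} (hp : p ∈ Icc 0 m) : 0 < N p := by
  refine lt_of_le_of_ne (h.nonneg p) fun h0 => ?_
  have hm : m ∈ Icc (-m) m := ⟨by linarith [hp.1, hp.2], le_rfl⟩
  have hp' : p ∈ Icc (-m) m := ⟨by linarith [hp.1, hp.2], hp.2⟩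
  rcases hp.2.eq_or_lt with rfl | hlt
  · exact h.ne_zero h0.symm
  have hsub : Ioo p m ⊆ N ⁻¹' {0} := by
    rintro x ⟨hx1, hx2⟩
    have hden : 0 < m - p := sub_pos.2 hlt
    have hle := h.le_mul p hp' m hm ((m - x) / (m - p)) ((x - p) / (m - p))
      (div_nonneg (by linarith) hden.le) (div_nonneg (by linarith) hden.le)
      (by field_simp; ring)
    have hx : (m - x) / (m - p) * p + (x - p) / (m - p) * m = x := by field_simp; ring
    rw [hx, ← h0, Real.zero_rpow (div_pos (by linarith) hden).ne', zero_mul] at hle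
    exact le_antisymm hle (h.nonneg x)
  have := closure_minimal hsub (isClosed_singleton.preimage h.continuous)
  rw [closure_Ioo hlt.ne] at this
  exact h.ne_zero (this ⟨hp.2, le_rfl⟩)

lemma convexOn : ConvexOn ℝ (Icc (-m) m) N := by
  refine ⟨convex_Icc _ _, fun a ha b hb t s ht hs hts => ?_⟩
  exact (h.le_mul a ha b hb t s ht hs hts).trans
    (Real.geom_mean_le_arith_mean2_weighted ht hs (h.nonneg _) (h.nonneg _) hts)

lemma convexOn_log : ConvexOn ℝ (Icc 0 m) fun p => Real.log (N p) := by
  refine ⟨convex_Icc _ _, fun a ha b hb t s ht hs hts => ?_⟩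
  have hmem := (convex_Icc 0 m) ha hb ht hs hts
  have hsub : ∀ p ∈ Icc 0 m, p ∈ Icc (-m) m := fun p hp => ⟨by linarith [hp.1, hp.2], hp.2⟩
  have hle := h.le_mul a (hsub a ha) b (hsub b hb) t s ht hs hts
  have ha' := h.pos ha
  have hb' := h.pos hb
  have := Real.log_le_log (h.pos hmem) hle
  rwa [Real.log_mul (Real.rpow_pos_of_pos ha' _).ne' (Real.rpow_pos_of_pos hb' _).ne',
    Real.log_rpow ha', Real.log_rpow hb'] at this

lemma monotoneOn : MonotoneOn N (Icc 0 m) := by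
  intro a ha b hb hab
  have := h.convexOn.le_max_of_mem_Icc (x := -b) (y := b) (z := a)
    ⟨by linarith [hb.2], by linarith [hb.1, hb.2]⟩ ⟨by linarith [hb.1, hb.2], hb.2⟩
    ⟨by linarith [ha.1, hb.1], hab⟩
  rwa [h.even b ⟨by linarith [hb.1, hb.2], hb.2⟩, max_self] at this

lemma reflected {κ : ℝ} (hκ : 0 < κ) :
    ConvexOn ℝ (Icc 0 m) (fun p => κ * N (m - p)) ∧
    AntitoneOn (fun p => κ * N (m - p)) (Icc 0 m) ∧
    (∀ p ∈ Icc 0 m, 0 < κ * N (m - p)) ∧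
    ConvexOn ℝ (Icc 0 m) fun p => Real.log (κ * N (m - p)) := by
  have hrefl : ∀ p ∈ Icc 0 m, m - p ∈ Icc 0 m := fun p hp =>
    ⟨by linarith [hp.2], by linarith [hp.1]⟩
  have hsub : ∀ p ∈ Icc 0 m, p ∈ Icc (-m) m := fun p hp => ⟨by linarith [hp.1, hp.2], hp.2⟩
  have haff : ∀ a b t s : ℝ, t + s = 1 → m - (t * a + s * b) = t * (m - a) + s * (m - b) :=
    fun a b t s hts => by linear_combination (-m) * hts
  refine ⟨⟨convex_Icc _ _, fun a ha b hb t s ht hs hts => ?_⟩, fun a ha b hb hab => ?_,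
    fun p hp => mul_pos hκ (h.pos (hrefl p hp)),
    ⟨convex_Icc _ _, fun a ha b hb t s ht hs hts => ?_⟩⟩
  · have := h.convexOn.2 (hsub _ (hrefl a ha)) (hsub _ (hrefl b hb)) ht hs hts
    simp only [smul_eq_mul] at this ⊢
    rw [haff _ _ _ _ hts]
    calc κ * N (t * (m - a) + s * (m - b)) ≤ κ * (t * N (m - a) + s * N (m - b)) := by gcongr
      _ = _ := by ring
  · have := h.monotoneOn (hrefl b hb) (hrefl a ha) (by linarith)
    simp only
    gcongr
  · have h1 := h.convexOn_log.2 (hrefl a ha) (hrefl b hb) ht hs hts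
    have hmem := (convex_Icc 0 m) (hrefl a ha) (hrefl b hb) ht hs hts
    simp only [smul_eq_mul] at h1 hmem ⊢
    rw [haff _ _ _ _ hts, Real.log_mul hκ.ne' (h.pos hmem).ne',
      Real.log_mul hκ.ne' (h.pos (hrefl a ha)).ne', Real.log_mul hκ.ne' (h.pos (hrefl b hb)).ne']
    have hκ' : Real.log κ = t * Real.log κ + s * Real.log κ := by rw [← add_mul, hts, one_mul]
    linarith

end EvenLogConvex

end EvenLogConvex

/-! ### Energies of a symmetric flow -/

namespace SymmetricFlow

open Complex Metric Topology Filter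
open scoped Interval ComplexConjugate

variable (S : SymmetricFlow)

lemma evenLogConvex_lineMean {k : ℂ → ℂ} (hk : ∀ Z, DifferentiableAt ℂ k (S.U Z))
    (hconj : ∀ u, ‖k (conj u)‖ = ‖k u‖) {r : ℝ} (hr : 1 ≤ r)
    (hne : ∃ x : ℝ, k (S.U (x + S.H x * I)) ≠ 0) :
    EvenLogConvex (lineMean (fun ζ => k (S.U (S.conformalInverse ζ))) r S.period) S.flux := by
  have hr0 : 0 < r := one_pos.trans_le hr
  have hfl := S.flux_pos
  have hper := S.period_pos
  have hG := S.continuous_conformalInverse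
  have hkU : Continuous fun Z => k (S.U Z) := continuous_iff_continuousAt.2 fun Z =>
    (hk Z).continuousAt.comp S.U_cont.continuousAt
  have hf : Continuous fun ζ => k (S.U (S.conformalInverse ζ)) := hkU.comp hG
  have hper' : ∀ ζ : ℂ, |ζ.im| ≤ S.flux → k (S.U (S.conformalInverse (ζ + S.period))) =
      k (S.U (S.conformalInverse ζ)) := fun ζ hζ => by
    rw [S.conformalInverse_add_period hζ, S.U_per]
  obtain ⟨B, hB⟩ := S.exists_bound_of_periodic hkU fun Z => by rw [S.U_per]
  refine ⟨fun p => lineMean_nonneg _ _ hper.le p, continuous_lineMean hf hr0.le _, fun p hp => ?_,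
    fun a ha b hb t s ht hs hts => lineMean_le_rpow_mul_rpow hf ?_
      (fun ζ => hB _ (S.conformalInverse_mem ζ)) hper.le hper' hr ha hb ht hs hts, ?_⟩
  · have hp' : |p| ≤ S.flux := abs_le.2 hp
    unfold lineMean
    congr 1; ext q
    have : (q : ℂ) + (-p : ℝ) * I = conj ((q : ℂ) + p * I) := by simp
    simp only
    rw [this, S.conformalInverse_conj (S.strip_mem hp' q), S.U_conj, hconj]
  · intro ζ hζ
    have hZ := S.conformalInverse_mem_openDomain hζ
    have h1 : DifferentiableAt ℂ (fun ζ => S.U (S.conformalInverse ζ)) ζ :=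
      (S.U_diff.differentiableAt (S.isOpen_openDomain.mem_nhds hZ)).comp ζ
        (S.hasDerivAt_conformalInverse hζ).differentiableAt
    exact (DifferentiableAt.comp (g := k) (f := fun ζ => S.U (S.conformalInverse ζ)) ζ (hk _) h1)
      |>.differentiableWithinAt
  · obtain ⟨x, hx⟩ := hne
    have hZ := S.surface_mem x
    have hP := S.periodic_comp_conformalInverse (E := fun Z => ‖k (S.U Z)‖ ^ r)
      (fun Z => by rw [S.U_per]) (p := S.flux) (by rw [abs_of_pos hfl])
    have h1 := hP.intervalIntegral_add_eq (S.potential (x + S.H x * I)).re 0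
    rw [zero_add] at h1
    rw [lineMean, ← h1]
    refine (intervalIntegral.integral_pos (by linarith) (Continuous.continuousOn ?_)
      (fun _ _ => by positivity) ⟨(S.potential (x + S.H x * I)).re, by simp [hper.le], ?_⟩).ne'
    · exact (hf.comp (by fun_prop)).norm.rpow_const fun _ => Or.inr hr0.le
    · rw [← S.potential_surface_im x, re_add_im, S.conformalInverse_eq hZ rfl]
      positivity

lemma U_mem_slitPlane (Z : ℂ) : S.U Z ∈ slitPlane := Or.inl (S.U_re_pos Z)

lemma normSq_rpow (u : ℂ) (s : ℝ) : normSq u ^ s = ‖u‖ ^ (2 * s) := by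
  rw [normSq_eq_norm_sq, ← Real.rpow_natCast, ← Real.rpow_mul (norm_nonneg _)]; norm_num

/-- The integral of `|U + v| ^ (2 s)` over one travel time is an even logarithmically convex
function of the streamline. The conditions on `s` are those under which `|U + v| ^ (2 s) / |U| ^ 2`
is `‖k (U)‖ ^ r` with `1 ≤ r` and `k` built from `(u + v) ^ (± 1)`, which needs no branch of a
power, and from real powers of `u`, whose principal branch is holomorphic on the values of `U`. -/
theorem exists_evenLogConvex_energy {v s : ℝ}
    (hs : v = 0 ∨ s ≤ -(1 / 2) ∨ 1 / 2 ≤ s ∨ s = 0)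
    (hneg : s < 0 → ∀ Z, S.U Z + v ≠ 0)
    (hpos : 0 < s → ∃ x : ℝ, S.U (x + S.H x * I) + v ≠ 0) :
    ∃ N, EvenLogConvex N S.flux ∧ ∀ p : ℝ, ∫ q in 0..S.period,
      normSq (S.U (S.conformalInverse (q + p * I)) + v) ^ s / S.speedSq p q = N p := by
  -- it suffices to write the integrand as `‖k (U)‖ ^ r` with `k` holomorphic and `1 ≤ r`
  suffices h : ∃ (k : ℂ → ℂ) (r : ℝ), 1 ≤ r ∧ (∀ Z, DifferentiableAt ℂ k (S.U Z)) ∧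
      (∀ u, ‖k (conj u)‖ = ‖k u‖) ∧ (∃ x : ℝ, k (S.U (x + S.H x * I)) ≠ 0) ∧
      ∀ Z, ‖k (S.U Z)‖ ^ r = normSq (S.U Z + v) ^ s / normSq (S.U Z) by
    obtain ⟨k, r, hr, hk, hconj, hne, heq⟩ := h
    refine ⟨_, S.evenLogConvex_lineMean hk hconj hr hne, fun p => ?_⟩
    unfold lineMean speedSq
    congr 1; ext q
    rw [heq]
  have hU0 : ∀ Z, 0 < ‖S.U Z‖ := fun Z => norm_pos_iff.2 (S.U_ne_zero Z)
  have hcpow : ∀ (β : ℝ) Z, DifferentiableAt ℂ (fun u : ℂ => u ^ (β : ℂ)) (S.U Z) := fun β Z =>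
    differentiableAt_id.cpow_const (S.U_mem_slitPlane Z)
  have hconjv : ∀ u : ℂ, ‖conj u + v‖ = ‖u + v‖ := fun u => by
    rw [← RCLike.norm_conj (u + v), map_add, conj_ofReal]
  have pure : (∀ Z, normSq (S.U Z + v) ^ s = ‖S.U Z‖ ^ (2 * s)) →
      ∃ (k : ℂ → ℂ) (r : ℝ), 1 ≤ r ∧ (∀ Z, DifferentiableAt ℂ k (S.U Z)) ∧
      (∀ u, ‖k (conj u)‖ = ‖k u‖) ∧ (∃ x : ℝ, k (S.U (x + S.H x * I)) ≠ 0) ∧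
      ∀ Z, ‖k (S.U Z)‖ ^ r = normSq (S.U Z + v) ^ s / normSq (S.U Z) := by
    intro h
    refine ⟨fun u => u ^ ((2 * s - 2 : ℝ) : ℂ), 1, le_rfl, hcpow _, fun u => ?_, ⟨0, ?_⟩,
      fun Z => ?_⟩
    · rw [norm_cpow_real, norm_cpow_real, RCLike.norm_conj]
    · rw [← norm_pos_iff, norm_cpow_real]
      exact Real.rpow_pos_of_pos (hU0 _) _
    · rw [h, norm_cpow_real, Real.rpow_one, Real.rpow_sub (hU0 Z), normSq_eq_norm_sq]
      norm_num
  -- `k u` is `u ^ (2 s - 2)`, or `(u + v)⁻¹ u ^ (1 / s)`, or `(u + v) u ^ (- 1 / s)`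
  rcases hs with rfl | hs | hs | rfl
  · exact pure fun Z => by rw [ofReal_zero, add_zero, normSq_rpow]
  · have hs0 : s < 0 := by linarith
    have hV := hneg hs0
    refine ⟨fun u => (u + v)⁻¹ * u ^ ((1 / s : ℝ) : ℂ), -2 * s, by linarith, fun Z => ?_,
      fun u => ?_, ⟨0, ?_⟩, fun Z => ?_⟩
    · have h1 : DifferentiableAt ℂ (fun u : ℂ => u + v) (S.U Z) := differentiableAt_id.add_const _
      exact (h1.fun_inv (hV Z)).fun_mul (hcpow _ Z)
    · rw [norm_mul, norm_mul, norm_inv, norm_inv, norm_cpow_real, norm_cpow_real,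
        RCLike.norm_conj, hconjv]
    · refine mul_ne_zero (inv_ne_zero (hV _)) ?_
      rw [← norm_pos_iff, norm_cpow_real]
      exact Real.rpow_pos_of_pos (hU0 _) _
    · rw [norm_mul, norm_inv, norm_cpow_real, Real.mul_rpow (by positivity) (by positivity),
        ← Real.rpow_mul (norm_nonneg _), normSq_rpow, normSq_eq_norm_sq]
      have e1 : 1 / s * (-2 * s) = -2 := by have := hs0.ne; field_simp
      have e2 : ‖S.U Z + v‖⁻¹ ^ (-2 * s) = ‖S.U Z + v‖ ^ (2 * s) := by
        rw [Real.inv_rpow (norm_nonneg _), ← Real.rpow_neg (norm_nonneg _)]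
        congr 1; ring
      rw [e1, e2, Real.rpow_neg (norm_nonneg _), Real.rpow_two, div_eq_mul_inv]
  · have hs0 : 0 < s := by linarith
    refine ⟨fun u => (u + v) * u ^ ((-1 / s : ℝ) : ℂ), 2 * s, by linarith, fun Z => ?_,
      fun u => ?_, ?_, fun Z => ?_⟩
    · exact (differentiableAt_id.add_const _).mul (hcpow _ Z)
    · rw [norm_mul, norm_mul, norm_cpow_real, norm_cpow_real, RCLike.norm_conj, hconjv]
    · obtain ⟨x, hx⟩ := hpos hs0
      refine ⟨x, mul_ne_zero hx ?_⟩
      rw [← norm_pos_iff, norm_cpow_real]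
      exact Real.rpow_pos_of_pos (hU0 _) _
    · rw [norm_mul, norm_cpow_real, Real.mul_rpow (by positivity) (by positivity),
        ← Real.rpow_mul (norm_nonneg _), normSq_rpow, normSq_eq_norm_sq]
      have e1 : -1 / s * (2 * s) = -2 := by field_simp
      rw [e1, Real.rpow_neg (norm_nonneg _), Real.rpow_two, div_eq_mul_inv]
  · exact pure fun Z => by simp

end SymmetricFlow

/-! ### The symmetric flow of an equatorial Stokes wave -/

namespace EquatorialStokesWave

open Complex Metric Topology Filter
open scoped Interval ComplexConjugate

variable (W : EquatorialStokesWave)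

/-- The complex velocity in the moving frame, as a function of `x + i y` with `y = z + d`. The wave
occupies `0 ≤ y ≤ η x + d`; the velocity is reflected across the bed `y = 0` and continued
constantly along vertical rays beyond the surface. The vertical velocity is odd in `y`: of its two
terms, one is evaluated at the bed, where it is `0`. -/
noncomputable def complexVelocity (Z : ℂ) : ℂ :=
  (W.u (Z.re, min |Z.im| (W.η Z.re + W.d) - W.d) - W.c : ℝ) -
    (W.w (Z.re, min (max Z.im 0) (W.η Z.re + W.d) - W.d) -
      W.w (Z.re, min (max (-Z.im) 0) (W.η Z.re + W.d) - W.d) : ℝ) * I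

lemma depth_pos (x : ℝ) : 0 < W.η x + W.d := by linarith [W.bed_lt_surface x]

lemma clamp_mem {x y : ℝ} (hy : 0 ≤ y) : (x, min y (W.η x + W.d) - W.d) ∈ layer W.d W.η := by
  have h1 := W.depth_pos x
  have h2 := min_le_right y (W.η x + W.d)
  have h3 : 0 ≤ min y (W.η x + W.d) := le_min hy h1.le
  exact ⟨by simp only; linarith, by simp only; linarith⟩

lemma complexVelocity_re (Z : ℂ) : (W.complexVelocity Z).re =
    W.u (Z.re, min |Z.im| (W.η Z.re + W.d) - W.d) - W.c := by
  simp [complexVelocity]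

lemma complexVelocity_im (Z : ℂ) : (W.complexVelocity Z).im =
    -(W.w (Z.re, min (max Z.im 0) (W.η Z.re + W.d) - W.d) -
      W.w (Z.re, min (max (-Z.im) 0) (W.η Z.re + W.d) - W.d)) := by
  simp [complexVelocity]

lemma complexVelocity_of_mem {x y : ℝ} (h0 : 0 ≤ y) (h1 : y ≤ W.η x + W.d) :
    W.complexVelocity (x + y * I) =
      (W.u (x, y - W.d) - W.c : ℝ) - (W.w (x, y - W.d) : ℝ) * I := by
  have h2 := W.depth_pos x
  have h3 := W.kinematic_bed x
  simp only [complexVelocity, add_re, ofReal_re, mul_re, I_re, mul_zero, ofReal_im, I_im,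
    add_im, mul_im, mul_one, zero_add, add_zero, sub_self]
  rw [abs_of_nonneg h0, min_eq_left h1, max_eq_left h0, min_eq_left h1,
    max_eq_right (by linarith : -y ≤ 0), min_eq_left h2.le, zero_sub, h3, sub_zero]

lemma continuous_complexVelocity : Continuous W.complexVelocity := by
  have hη := W.smooth_η.continuous
  have hw : ∀ f : ℂ → ℝ, Continuous f → (∀ Z, 0 ≤ f Z) →
      Continuous fun Z : ℂ => W.w (Z.re, min (f Z) (W.η Z.re + W.d) - W.d) := fun f hf h0 =>
    W.smooth_w.continuousOn.comp_continuous (by fun_prop) fun Z => W.clamp_mem (h0 Z)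
  have hu : Continuous fun Z : ℂ => W.u (Z.re, min |Z.im| (W.η Z.re + W.d) - W.d) :=
    W.smooth_u.continuousOn.comp_continuous (by fun_prop) fun Z => W.clamp_mem (abs_nonneg _)
  have h1 := hw (fun Z => max Z.im 0) (by fun_prop) fun Z => le_max_right _ _
  have h2 := hw (fun Z => max (-Z.im) 0) (by fun_prop) fun Z => le_max_right _ _
  unfold complexVelocity
  fun_prop

lemma complexVelocity_conj (Z : ℂ) :
    W.complexVelocity (conj Z) = conj (W.complexVelocity Z) := by
  apply Complex.ext
  · rw [conj_re, complexVelocity_re, complexVelocity_re, conj_re, conj_im, abs_neg]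
  · rw [conj_im, complexVelocity_im, complexVelocity_im, conj_re, conj_im, neg_neg]
    ring

lemma complexVelocity_add_L (Z : ℂ) : W.complexVelocity (Z + W.L) = W.complexVelocity Z := by
  have hu := W.periodic_u _ (W.clamp_mem (x := Z.re) (abs_nonneg Z.im))
  have hw1 := W.periodic_w _ (W.clamp_mem (x := Z.re) (le_max_right Z.im 0))
  have hw2 := W.periodic_w _ (W.clamp_mem (x := Z.re) (le_max_right (-Z.im) 0))
  simp only at hu hw1 hw2
  apply Complex.ext
  · simp [complexVelocity_re, W.periodic_η, hu]
  · simp [complexVelocity_im, W.periodic_η, hw1, hw2]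

lemma isOpen_openLayer : IsOpen (openLayer W.d W.η) := by
  have hη := W.smooth_η.continuous
  exact (isOpen_lt continuous_const continuous_snd).inter
    (isOpen_lt continuous_snd (by fun_prop))

lemma partialX_eq_fderiv {f : ℝ × ℝ → ℝ} {a : ℝ × ℝ} (hf : DifferentiableAt ℝ f a) :
    partialX f a = fderiv ℝ f a (1, 0) := by
  have h : HasDerivAt (fun x : ℝ => (x, a.2)) ((1 : ℝ), (0 : ℝ)) a.1 :=
    (hasDerivAt_id _).prodMk (hasDerivAt_const _ _)
  exact (hf.hasFDerivAt.comp_hasDerivAt a.1 h).deriv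

lemma partialZ_eq_fderiv {f : ℝ × ℝ → ℝ} {a : ℝ × ℝ} (hf : DifferentiableAt ℝ f a) :
    partialZ f a = fderiv ℝ f a (0, 1) := by
  have h : HasDerivAt (fun z : ℝ => (a.1, z)) ((0 : ℝ), (1 : ℝ)) a.2 :=
    (hasDerivAt_const _ _).prodMk (hasDerivAt_id _)
  exact (hf.hasFDerivAt.comp_hasDerivAt a.2 h).deriv

/-- Incompressibility and irrotationality are the Cauchy-Riemann equations of the complex velocity.
-/
lemma differentiableAt_complexVelocity_of_im_pos {Z : ℂ} (h0 : 0 < Z.im)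
    (h1 : Z.im < W.η Z.re + W.d) : DifferentiableAt ℂ W.complexVelocity Z := by
  have hη := W.smooth_η.continuous
  have ha : (Z.re, Z.im - W.d) ∈ openLayer W.d W.η :=
    ⟨by simp only; linarith, by simp only; linarith⟩
  have hsub : openLayer W.d W.η ⊆ layer W.d W.η := fun a h => ⟨h.1.le, h.2.le⟩
  have hnhds : layer W.d W.η ∈ 𝓝 (Z.re, Z.im - W.d) :=
    mem_of_superset (W.isOpen_openLayer.mem_nhds ha) hsub
  have hu := (W.smooth_u.contDiffAt hnhds).differentiableAt (by simp)
  have hw := (W.smooth_w.contDiffAt hnhds).differentiableAt (by simp)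
  have e1 := W.incompressible _ ha
  have e2 := W.irrotational _ ha
  rw [partialX_eq_fderiv hu, partialZ_eq_fderiv hw] at e1
  rw [partialZ_eq_fderiv hu, partialX_eq_fderiv hw] at e2
  have hev : (fun Y : ℂ => ((W.u (Y.re, Y.im - W.d) - W.c : ℝ) : ℂ) -
      (W.w (Y.re, Y.im - W.d) : ℝ) * I) =ᶠ[𝓝 Z] W.complexVelocity := by
    have o1 : ∀ᶠ Y : ℂ in 𝓝 Z, 0 < Y.im := continuous_im.continuousAt.eventually (lt_mem_nhds h0)
    have o2 : ∀ᶠ Y : ℂ in 𝓝 Z, Y.im < W.η Y.re + W.d :=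
      ContinuousAt.eventually_lt (f := fun Y : ℂ => Y.im) (g := fun Y : ℂ => W.η Y.re + W.d)
        (by fun_prop) (by fun_prop) h1
    filter_upwards [o1, o2] with Y hY1 hY2
    rw [← W.complexVelocity_of_mem hY1.le hY2.le, re_add_im]
  refine DifferentiableAt.congr_of_eventuallyEq ?_ hev.symm
  have hι : HasFDerivAt (fun Y : ℂ => (Y.re, Y.im - W.d)) (reCLM.prod imCLM) Z :=
    reCLM.hasFDerivAt.prodMk (imCLM.hasFDerivAt.sub_const _)
  have hfu := hu.hasFDerivAt.comp Z hι
  have hfw := hw.hasFDerivAt.comp Z hι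
  have hF := (ofRealCLM.hasFDerivAt.comp Z (hfu.sub_const W.c)).sub
    ((ofRealCLM.hasFDerivAt.comp Z hfw).mul_const I)
  refine differentiableAt_complex_iff_differentiableAt_real.2 ⟨hF.differentiableAt, ?_⟩
  have hFd := hF.fderiv
  change fderiv ℝ (fun Y : ℂ => ((W.u (Y.re, Y.im - W.d) - W.c : ℝ) : ℂ) -
      (W.w (Y.re, Y.im - W.d) : ℝ) * I) Z = _ at hFd
  rw [hFd]
  apply Complex.ext
  · simp
    linarith
  · simp
    linarith

/-- The flow of the wave in the moving frame, reflected across the bed. -/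
noncomputable def toSymmetricFlow : SymmetricFlow where
  L := W.L
  H x := W.η x + W.d
  U := W.complexVelocity
  L_pos := W.L_pos
  smooth_H := (W.smooth_η.of_le (by simp)).add contDiff_const
  H_pos := W.depth_pos
  H_per x := by rw [W.periodic_η]
  U_cont := W.continuous_complexVelocity
  U_diff := by
    have hη := W.smooth_η.continuous
    refine differentiableOn_of_continuousOn_of_im_ne_zero (isOpen_lt (by fun_prop) (by fun_prop))
      W.continuous_complexVelocity.continuousOn fun Z hZ h0 => ?_
    rw [mem_ofPred_eq, abs_lt] at hZ
    rcases h0.lt_or_gt with h0 | h0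
    · have h := W.differentiableAt_complexVelocity_of_im_pos (Z := conj Z)
        (by rw [conj_im]; linarith) (by rw [conj_im, conj_re]; linarith)
      have := h.conj_conj
      have heq : conj ∘ W.complexVelocity ∘ conj = W.complexVelocity := funext fun Y => by
        rw [Function.comp_apply, Function.comp_apply, complexVelocity_conj, conj_conj]
      rwa [conj_conj, heq] at this
    · exact W.differentiableAt_complexVelocity_of_im_pos h0 hZ.2
  U_re_pos Z := by
    rw [complexVelocity_re, sub_pos]
    exact W.speed_lt_u _ (W.clamp_mem (abs_nonneg _))
  U_per := W.complexVelocity_add_L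
  U_conj := W.complexVelocity_conj
  U_surface x := by
    have h := W.kinematic_surface x
    have h1 : deriv (fun x => W.η x + W.d) x = deriv W.η x := deriv_add_const _
    rw [mk_eq_add_mul_I, W.complexVelocity_of_mem (W.depth_pos x).le le_rfl, h1,
      add_sub_cancel_right]
    simp
    linarith

/-! ### Streamlines, particle paths and energies of the wave -/

/-- The point of the complex plane which corresponds to `a`, with the bed on the real axis. -/
noncomputable def toComplex (a : ℝ × ℝ) : ℂ := a.1 + (a.2 + W.d : ℝ) * I

lemma toComplex_re (a : ℝ × ℝ) : (W.toComplex a).re = a.1 := by simp [toComplex]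

lemma toComplex_im (a : ℝ × ℝ) : (W.toComplex a).im = a.2 + W.d := by simp [toComplex]

lemma toComplex_mem {a : ℝ × ℝ} (ha : a ∈ W.domain) :
    W.toComplex a ∈ W.toSymmetricFlow.closedDomain := by
  obtain ⟨h1, h2⟩ := ha
  change |(W.toComplex a).im| ≤ W.η (W.toComplex a).re + W.d
  rw [toComplex_re, toComplex_im, abs_of_nonneg (by linarith)]
  linarith

lemma mem_domain_iff {x y : ℝ} : (x, y - W.d) ∈ W.domain ↔ 0 ≤ y ∧ y ≤ W.η x + W.d := by
  constructor
  · rintro ⟨h1, h2⟩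
    simp only at h1 h2
    constructor <;> linarith
  · rintro ⟨h1, h2⟩
    constructor <;> simp only <;> linarith

lemma complexVelocity_toComplex {a : ℝ × ℝ} (ha : a ∈ W.domain) :
    W.complexVelocity (W.toComplex a) = (W.u a - W.c : ℝ) - (W.w a : ℝ) * I := by
  obtain ⟨h1, h2⟩ := ha
  rw [toComplex, W.complexVelocity_of_mem (by linarith) (by linarith)]
  simp

lemma potential_toComplex_im {a : ℝ × ℝ} (ha : a ∈ W.domain) :
    (W.toSymmetricFlow.potential (W.toComplex a)).im =
      ∫ z in (-W.d)..a.2, (W.u (a.1, z) - W.c) := by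
  obtain ⟨h1, h2⟩ := ha
  rw [SymmetricFlow.potential_im, toComplex_re, toComplex_im]
  have : ∫ z in (-W.d)..a.2, (W.u (a.1, z) - W.c) =
      ∫ y in (0 : ℝ)..(a.2 + W.d), (W.u (a.1, y - W.d) - W.c) := by
    rw [intervalIntegral.integral_comp_sub_right (fun z => W.u (a.1, z) - W.c)]
    simp
  rw [this]
  refine intervalIntegral.integral_congr fun y hy => ?_
  rw [uIcc_of_le (by linarith)] at hy
  change (W.complexVelocity (a.1 + y * I)).re = _
  rw [W.complexVelocity_of_mem hy.1 (by linarith [hy.2])]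
  simp

lemma flux_eq : W.toSymmetricFlow.flux = |W.massFlux| := by
  have hmem : (0, W.η 0) ∈ W.domain := ⟨(W.bed_lt_surface 0).le, le_rfl⟩
  have h1 : W.toSymmetricFlow.flux = -W.massFlux := by
    rw [← W.toSymmetricFlow.potential_surface_im 0]
    change (W.toSymmetricFlow.potential (W.toComplex (0, W.η 0))).im = _
    rw [W.potential_toComplex_im hmem, massFlux, ← intervalIntegral.integral_neg]
    simp
  have h2 := W.toSymmetricFlow.flux_pos
  rw [abs_of_neg (by linarith), h1]

lemma streamFunction_eq {a : ℝ × ℝ} (ha : a ∈ W.domain) :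
    W.streamFunction a = (W.toSymmetricFlow.potential (W.toComplex a)).im - |W.massFlux| := by
  have hmem : (a.1, W.η a.1) ∈ W.domain := ⟨(W.bed_lt_surface _).le, le_rfl⟩
  have hint : ∀ p q : ℝ, p ∈ Icc (-W.d) (W.η a.1) → q ∈ Icc (-W.d) (W.η a.1) →
      IntervalIntegrable (fun z => W.u (a.1, z) - W.c) volume p q := by
    intro p q hp hq
    refine ContinuousOn.intervalIntegrable ?_
    refine (W.smooth_u.continuousOn.comp (by fun_prop) fun z hz => ?_).sub continuousOn_const
    exact uIcc_subset_Icc hp hq hz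
  have hle := (W.bed_lt_surface a.1).le
  have h1 : (W.toSymmetricFlow.potential (W.toComplex (a.1, W.η a.1))).im = |W.massFlux| :=
    (W.toSymmetricFlow.potential_surface_im a.1).trans W.flux_eq
  rw [← h1, W.potential_toComplex_im ha, W.potential_toComplex_im hmem, streamFunction,
    ← intervalIntegral.integral_add_adjacent_intervals (hint (-W.d) a.2 ⟨le_rfl, hle⟩ ha)
      (hint a.2 (W.η a.1) ha ⟨hle, le_rfl⟩)]
  simp

/-- The stream function of the wave is normalised on the surface, that of the symmetric flow on the
bed: label `p` is the height `|m| - p`. -/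
lemma mem_streamline_iff {p : ℝ} {a : ℝ × ℝ} : a ∈ W.streamline p ↔
    a ∈ W.domain ∧ (W.toSymmetricFlow.potential (W.toComplex a)).im = |W.massFlux| - p := by
  refine and_congr_right fun ha => ?_
  rw [W.streamFunction_eq ha]
  constructor <;> intro h <;> linarith

lemma exists_complexVelocity_eq (Z : ℂ) : ∃ a ∈ W.domain,
    (W.complexVelocity Z).re = W.u a - W.c ∧
      ((W.complexVelocity Z).im = -W.w a ∨ (W.complexVelocity Z).im = W.w a) := by
  refine ⟨_, W.clamp_mem (abs_nonneg Z.im), W.complexVelocity_re Z, ?_⟩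
  have h2 := W.depth_pos Z.re
  have h3 := W.kinematic_bed Z.re
  rw [complexVelocity_im]
  rcases le_total 0 Z.im with h | h
  · left
    rw [abs_of_nonneg h, max_eq_left h, max_eq_right (by linarith : -Z.im ≤ 0), min_eq_left h2.le,
      zero_sub, h3, sub_zero]
  · right
    rw [abs_of_nonpos h, max_eq_right h, max_eq_left (by linarith : 0 ≤ -Z.im), min_eq_left h2.le,
      zero_sub, h3, zero_sub, neg_neg]

/-- The upper half of the symmetric domain is the fluid domain. -/
lemma mem_domain_of_potential_im_nonneg {Z : ℂ} (hZ : Z ∈ W.toSymmetricFlow.closedDomain)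
    (h : 0 ≤ (W.toSymmetricFlow.potential Z).im) : (Z.re, Z.im - W.d) ∈ W.domain := by
  have h1 := W.toSymmetricFlow.potential_im_lt_iff (Z := Z) (W := Z.re) (by simp)
  rw [SymmetricFlow.potential_ofReal_im, ofReal_im] at h1
  have hZ' : |Z.im| ≤ W.η Z.re + W.d := hZ
  exact W.mem_domain_iff.2 ⟨not_lt.1 fun hlt => absurd (h1.2 hlt) (not_lt.2 h),
    (abs_le.1 hZ').2⟩

lemma toComplex_eq (Z : ℂ) : W.toComplex (Z.re, Z.im - W.d) = Z := by
  simp [toComplex]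

lemma streamline_nonempty {p : ℝ} (hp : p ∈ Icc 0 |W.massFlux|) : (W.streamline p).Nonempty := by
  set ζ : ℂ := (|W.massFlux| - p : ℝ) * I with hζ
  have him : ζ.im = |W.massFlux| - p := by rw [hζ, im_ofReal_mul, I_im, mul_one]
  have hbd : |ζ.im| ≤ W.toSymmetricFlow.flux := by
    rw [him, flux_eq, abs_of_nonneg (by linarith [hp.2])]
    linarith [hp.1]
  have hF := W.toSymmetricFlow.potential_conformalInverse hbd
  set Z := W.toSymmetricFlow.conformalInverse ζ with hZ
  refine ⟨(Z.re, Z.im - W.d), W.mem_streamline_iff.2 ⟨?_, by rw [toComplex_eq, hF, him]⟩⟩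
  exact W.mem_domain_of_potential_im_nonneg (W.toSymmetricFlow.conformalInverse_mem ζ)
    (by rw [hF, him]; linarith [hp.2])

/-- The path in the moving frame, as a curve in the complex plane. -/
noncomputable def movingPath (X Z : ℝ → ℝ) (t : ℝ) : ℂ := W.toComplex (X t - W.c * t, Z t)

variable {W}

lemma IsParticlePath.isPath {X Z : ℝ → ℝ} (h : W.IsParticlePath X Z) :
    W.toSymmetricFlow.IsPath (W.movingPath X Z) := by
  intro t
  obtain ⟨h1, h2, h3⟩ := h t
  refine ⟨W.toComplex_mem h1, ?_⟩
  change HasDerivAt (W.movingPath X Z) (conj (W.complexVelocity (W.toComplex _))) t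
  have hx : HasDerivAt (fun t => X t - W.c * t) (W.u (X t - W.c * t, Z t) - W.c) t := by
    have := h2.sub ((hasDerivAt_id t).const_mul W.c)
    rw [mul_one] at this
    exact this
  have := hx.ofReal_comp.add (((h3.add_const W.d).ofReal_comp).mul_const I)
  rw [W.complexVelocity_toComplex h1, map_sub, map_mul, conj_ofReal, conj_ofReal, conj_I,
    mul_neg, sub_neg_eq_add]
  exact this

lemma energyDensity_eq {X Z : ℝ → ℝ} (h : W.IsParticlePath X Z) (v s : ℝ) :
    energyDensity v s X Z = fun t =>
      normSq (W.toSymmetricFlow.U (W.movingPath X Z t) + (W.c - v : ℝ)) ^ s := by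
  funext t
  obtain ⟨h1, h2, h3⟩ := h t
  change _ = normSq (W.complexVelocity (W.toComplex _) + (W.c - v : ℝ)) ^ s
  rw [W.complexVelocity_toComplex h1, energyDensity, h2.deriv, h3.deriv, normSq_apply]
  congr 1
  simp
  ring

lemma exists_isParticlePath {a : ℝ × ℝ} (ha : a ∈ W.domain) :
    ∃ X Z : ℝ → ℝ, W.IsParticlePath X Z ∧ (X 0, Z 0) = a := by
  obtain ⟨γ, hγ, hγ0, him⟩ := W.toSymmetricFlow.exists_path (W.toComplex_mem ha)
  have hnonneg : 0 ≤ (W.toSymmetricFlow.potential (W.toComplex a)).im := by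
    rw [W.potential_toComplex_im ha]
    refine intervalIntegral.integral_nonneg ha.1 fun z hz => ?_
    exact sub_nonneg.2 (W.speed_lt_u _ ⟨hz.1, hz.2.trans ha.2⟩).le
  refine ⟨fun t => (γ t).re + W.c * t, fun t => (γ t).im - W.d, fun t => ?_, ?_⟩
  · have hdom := W.mem_domain_of_potential_im_nonneg (hγ t).1 (by rw [him]; exact hnonneg)
    have hU := W.complexVelocity_toComplex hdom
    rw [toComplex_eq] at hU
    change W.toSymmetricFlow.U (γ t) = _ at hU
    have hd := (hγ t).2
    rw [hU, map_sub, map_mul, conj_ofReal, conj_ofReal, conj_I, mul_neg, sub_neg_eq_add] at hd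
    simp only [add_sub_cancel_right]
    refine ⟨hdom, ?_, ?_⟩
    · have h1 := reCLM.hasFDerivAt.comp_hasDerivAt t hd
      have h2 := h1.add ((hasDerivAt_id t).const_mul W.c)
      simp only [reCLM_apply, add_re, ofReal_re, re_ofReal_mul, I_re, mul_zero, add_zero, mul_one,
        sub_add_cancel] at h2
      exact h2
    · have h1 := (imCLM.hasFDerivAt.comp_hasDerivAt t hd).sub_const W.d
      simp only [imCLM_apply, add_im, ofReal_im, im_ofReal_mul, I_im, mul_one, zero_add] at h1
      exact h1
  · simp [hγ0, toComplex_re, toComplex_im]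

lemma IsParticlePath.isTimePeriod_iff {X Z : ℝ → ℝ} (h : W.IsParticlePath X Z) {p : ℝ}
    (hp : (X 0, Z 0) ∈ W.streamline p) (τ : ℝ) :
    W.IsTimePeriod X τ ↔ τ = W.toSymmetricFlow.travelTime (|W.massFlux| - p) := by
  have h0 : W.movingPath X Z 0 = W.toComplex (X 0, Z 0) := by simp [movingPath]
  have h1 := h.isPath.re_eq_add_L_iff_travelTime τ
  have h2 : (W.movingPath X Z τ).re = X τ - W.c * τ := W.toComplex_re _
  rw [h2, h0, toComplex_re, (W.mem_streamline_iff.1 hp).2] at h1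
  rw [← h1]
  refine ⟨fun h => h.2, fun h3 => ⟨?_, h3⟩⟩
  rw [h1.1 h3]
  exact W.toSymmetricFlow.travelTime_pos _

/-- The energy in the frame moving with speed `v`, where the complex velocity is `U + (c - v)`. -/
theorem exists_energy (W : EquatorialStokesWave) {v s : ℝ}
    (hs : v = W.c ∨ s ≤ -(1 / 2) ∨ 1 / 2 ≤ s ∨ s = 0)
    (hneg : s < 0 → ∀ a ∈ W.domain, (W.u a - v, W.w a) ≠ (0, 0)) :
    ∃ energy : ℝ → ℝ,
      (∀ p ∈ Icc 0 |W.massFlux|, ∀ X Z : ℝ → ℝ, W.IsParticlePath X Z →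
        (X 0, Z 0) ∈ W.streamline p →
        IntervalIntegrable (energyDensity v s X Z) volume 0
          (W.toSymmetricFlow.travelTime (|W.massFlux| - p)) ∧
        totalEnergy v s (W.toSymmetricFlow.travelTime (|W.massFlux| - p)) X Z = energy p) ∧
      ConvexOn ℝ (Icc 0 |W.massFlux|) energy ∧
      AntitoneOn energy (Icc 0 |W.massFlux|) ∧
      (∀ p ∈ Icc 0 |W.massFlux|, 0 < energy p) ∧
      ConvexOn ℝ (Icc 0 |W.massFlux|) (fun p => Real.log (energy p)) := by
  set S := W.toSymmetricFlow with hS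
  have hV : s < 0 → ∀ Z, S.U Z + (W.c - v : ℝ) ≠ 0 := fun hs0 Z h0 => by
    obtain ⟨a, ha, hre, him⟩ := W.exists_complexVelocity_eq Z
    change (S.U Z).re = _ at hre
    change (S.U Z).im = _ ∨ (S.U Z).im = _ at him
    have e1 := congrArg Complex.re h0
    have e2 := congrArg Complex.im h0
    rw [add_re, ofReal_re, zero_re] at e1
    rw [add_im, ofReal_im, add_zero, zero_im] at e2
    refine hneg hs0 a ha (Prod.ext (by simp only; linarith) ?_)
    simp only
    rcases him with him | him <;> linarith
  have hsurf : ∃ x : ℝ, S.U (x + S.H x * I) + (W.c - v : ℝ) ≠ 0 := by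
    by_contra! hall
    -- the flow would be horizontal along the surface, which would then be flat
    have hη' : ∀ x, deriv W.η x = 0 := fun x => by
      have e2 := congrArg Complex.im (hall x)
      rw [add_im, ofReal_im, add_zero, zero_im] at e2
      have h := S.U_surface x
      rw [mk_eq_add_mul_I, e2, zero_add] at h
      have h1 : deriv S.H x = deriv W.η x := deriv_add_const _
      rw [← h1]
      exact (mul_eq_zero.1 h).resolve_left (S.U_re_pos _).ne'
    have hconst := is_const_of_deriv_eq_zero (W.smooth_η.differentiable (by simp)) hη' 0 (W.L / 2)
    have hL := W.L_pos
    exact (W.strictAnti_η ⟨le_rfl, by linarith⟩ ⟨by linarith, le_rfl⟩ (by linarith)).ne' hconst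
  obtain ⟨N, hN, hNeq⟩ := S.exists_evenLogConvex_energy (v := W.c - v) (s := s) (by
      rcases hs with rfl | hs
      · left; exact sub_self _
      · right; exact hs) hV fun _ => hsurf
  have hNp := hN.reflected (κ := 1 / 2) (by norm_num)
  rw [flux_eq] at hNp
  refine ⟨fun p => 1 / 2 * N (|W.massFlux| - p), fun p hp X Y hXY h0 => ?_, hNp⟩
  have hd := energyDensity_eq hXY v s
  have hγ := hXY.isPath
  have hγ0 : W.movingPath X Y 0 = W.toComplex (X 0, Y 0) := by simp [movingPath]
  have him := (W.mem_streamline_iff.1 h0).2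
  rw [← hγ0] at him
  have hE : Continuous fun Z => normSq (S.U Z + (W.c - v : ℝ)) ^ s := by
    have h1 : Continuous fun Z => normSq (S.U Z + (W.c - v : ℝ)) :=
      continuous_normSq.comp (S.U_cont.add continuous_const)
    refine h1.rpow_const fun Z => ?_
    rcases lt_or_ge s 0 with hs0 | hs0
    · exact Or.inl (normSq_pos.2 (hV hs0 Z)).ne'
    · exact Or.inr hs0
  refine ⟨?_, ?_⟩
  · rw [hd]
    exact (hE.comp hγ.continuous).intervalIntegrable _ _
  · have hT := (hγ.potential_re_travelTime_iff _).2 rfl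
    rw [him] at hT
    have := hγ.integral_wavelength hE (fun Z => by rw [S.U_per]) hT
    rw [him, hNeq] at this
    rw [totalEnergy, hd, this]

end EquatorialStokesWave

theorem theorem5p2 (W : EquatorialStokesWave) :
    -- every streamline is non-empty, and a particle path starts at each point of the fluid
    (∀ p ∈ Icc 0 |W.massFlux|, (W.streamline p).Nonempty) ∧
    (∀ a ∈ W.domain, ∃ X Z : ℝ → ℝ, W.IsParticlePath X Z ∧ (X 0, Z 0) = a) ∧
    -- each particle has exactly one time-period, which depends on its streamline only
    ∃ T : ℝ → ℝ,
      (∀ p ∈ Icc 0 |W.massFlux|, ∀ X Z : ℝ → ℝ, W.IsParticlePath X Z →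
        (X 0, Z 0) ∈ W.streamline p → ∀ τ : ℝ, W.IsTimePeriod X τ ↔ τ = T p) ∧
      -- the fixed frame
      (∀ s : ℝ, (s ≤ -(1 / 2) ∨ 1 / 2 ≤ s ∨ s = 0) →
        (s < 0 → ∀ a ∈ W.domain, (W.u a, W.w a) ≠ (0, 0)) →
        ∃ energy : ℝ → ℝ,
          (∀ p ∈ Icc 0 |W.massFlux|, ∀ X Z : ℝ → ℝ, W.IsParticlePath X Z →
            (X 0, Z 0) ∈ W.streamline p →
            IntervalIntegrable (energyDensity 0 s X Z) volume 0 (T p) ∧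
            totalEnergy 0 s (T p) X Z = energy p) ∧
          ConvexOn ℝ (Icc 0 |W.massFlux|) energy ∧
          AntitoneOn energy (Icc 0 |W.massFlux|) ∧
          (∀ p ∈ Icc 0 |W.massFlux|, 0 < energy p) ∧
          ConvexOn ℝ (Icc 0 |W.massFlux|) (fun p => Real.log (energy p))) ∧
      -- the moving frame
      (∀ s : ℝ, (s ≤ 1 / 2 ∨ 3 / 2 ≤ s) →
        ∃ energy : ℝ → ℝ,
          (∀ p ∈ Icc 0 |W.massFlux|, ∀ X Z : ℝ → ℝ, W.IsParticlePath X Z →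
            (X 0, Z 0) ∈ W.streamline p →
            IntervalIntegrable (energyDensity W.c s X Z) volume 0 (T p) ∧
            totalEnergy W.c s (T p) X Z = energy p) ∧
          ConvexOn ℝ (Icc 0 |W.massFlux|) energy ∧
          AntitoneOn energy (Icc 0 |W.massFlux|) ∧
          (∀ p ∈ Icc 0 |W.massFlux|, 0 < energy p) ∧
          ConvexOn ℝ (Icc 0 |W.massFlux|) (fun p => Real.log (energy p))) := by
  refine ⟨fun p hp => W.streamline_nonempty hp,
    fun a ha => EquatorialStokesWave.exists_isParticlePath ha,
    fun p => W.toSymmetricFlow.travelTime (|W.massFlux| - p),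
    fun p _ X Z h h0 τ => h.isTimePeriod_iff h0 τ, fun s hs hneg => ?_, fun s _ => ?_⟩
  · exact W.exists_energy (Or.inr hs) fun hs0 a ha => by simpa using hneg hs0 a ha
  · refine W.exists_energy (Or.inl rfl) fun _ a ha h => ?_
    have := W.speed_lt_u a ha
    simp only [Prod.mk.injEq] at h
    linarith [h.1]
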